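/- Let $k$ be a field, $H$ a Hopf algebra over $k$ (its antipode need not be bijective), and let $A$ be a right $H$-comodule algebra, that is, an associative unital $k$-algebra with a right $H$-comodule structure $\rho_A : A \to A\otimes_k H$ which is a homomorphism of unital algebras. Suppose that $A$ is a simple object of the category ${}_A\mathcal M^H$ of left Hopf modules, i.e. $A \neq 0$ and $A$ has no nonzero proper left ideals stable under the coaction of $H$. Let $\mathcal M_A^H$ be the category of right Hopf modules, whose objects are the right $A$-modules $M$ equipped with a right $H$-comodule structure $M \to M\otimes_k H$, $m\mapsto\sum m_{(0)}\otimes m_{(1)}$, such that $\sum (ma)_{(0)}\otimes (ma)_{(1)}=\sum m_{(0)}a_{(0)}\otimes m_{(1)}a_{(1)}$ for all $m\in M$, $a\in A$. Then every object of $\mathcal M_A^H$ is a projective right $A$-module under any of the following additional assumptions: (a) $A$ is semiprime, two-sided (left and right) Noetherian, of finite global dimension; (b) $A$ is semiprime, two-sided (left and right) Goldie, right coherent (each finitely generated right ideal is a finitely presented right module), of finite weak dimension; (c) $A$ is von Neumann regular and at least one of its factor rings is simple Artinian. (The left and right global dimensions of a two-sided Noetherian ring coincide, and the weak dimension of any ring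 is the same whether computed with left or with right modules; finiteness is understood here as the existence of a common finite bound for the projective, respectively flat, dimensions of all right $A$-modules.) -/

import Mathlib

open scoped TensorProduct

namespace HopfMod

universe u v w x

/-! Right modules over a ring `A` are left modules over `Aᵐᵒᵖ`, so that `m · a = MulOpposite.op a • m`.
In particular right ideals of `A` are the elements of `Submodule Aᵐᵒᵖ A`, and left ideals those of
`Submodule A A`. -/

section Ring

/-- `A` is semiprime: `a A a = 0` forces `a = 0`. -/
def IsSemiprimeRing (A : Type w) [Ring A] : Prop :=
  ∀ a : A, (∀ r : A, a * r * a = 0) → a = 0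

/-- `A` is left and right Noetherian. -/
def IsTwoSidedNoetherian (A : Type w) [Ring A] : Prop :=
  IsNoetherian A A ∧ IsNoetherian Aᵐᵒᵖ A

/-- The right ideal `I` is the right annihilator of some subset `S` of `A`. -/
def IsRightAnnihilator {A : Type w} [Ring A] (I : Submodule Aᵐᵒᵖ A) : Prop :=
  ∃ S : Set A, ∀ a : A, a ∈ I ↔ ∀ s ∈ S, s * a = 0

/-- The left ideal `I` is the left annihilator of some subset `S` of `A`. -/
def IsLeftAnnihilator {A : Type w} [Ring A] (I : Submodule A A) : Prop :=
  ∃ S : Set A, ∀ a : A, a ∈ I ↔ ∀ s ∈ S, a * s = 0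

/-- A module has finite uniform dimension (Goldie rank): it contains no infinite direct sum of
nonzero submodules. -/
def HasFiniteUniformDim (R : Type u) (M : Type v) [Ring R] [AddCommGroup M] [Module R M] : Prop :=
  ¬ ∃ N : ℕ → Submodule R M, (∀ i, N i ≠ ⊥) ∧ iSupIndep N

/-- Right Goldie: finite right uniform dimension and the ascending chain condition on right
annihilators. -/
def IsRightGoldie (A : Type w) [Ring A] : Prop :=
  HasFiniteUniformDim Aᵐᵒᵖ A ∧
    ∀ I : ℕ →o Submodule Aᵐᵒᵖ A, (∀ n, IsRightAnnihilator (I n)) →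
      ∃ n, ∀ m, n ≤ m → I n = I m

/-- Left Goldie: finite left uniform dimension and the ascending chain condition on left
annihilators. -/
def IsLeftGoldie (A : Type w) [Ring A] : Prop :=
  HasFiniteUniformDim A A ∧
    ∀ I : ℕ →o Submodule A A, (∀ n, IsLeftAnnihilator (I n)) →
      ∃ n, ∀ m, n ≤ m → I n = I m

/-- Right coherent: each finitely generated right ideal is a finitely presented right module. -/
def IsRightCoherent (A : Type w) [Ring A] : Prop :=
  ∀ I : Submodule Aᵐᵒᵖ A, I.FG → Module.FinitePresentation Aᵐᵒᵖ I

/-- Von Neumann regular: each `a` is of the form `a b a`. -/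
def IsVonNeumannRegular (A : Type w) [Ring A] : Prop :=
  ∀ a : A, ∃ b : A, a * b * a = a

/-- Some factor ring of `A` is simple Artinian. -/
def HasSimpleArtinianFactor (A : Type w) [Ring A] : Prop :=
  ∃ (R : Type w) (_ : Ring R) (f : A →+* R),
    Function.Surjective f ∧ IsSimpleRing R ∧ IsArtinianRing R

/-- Finite (right) global dimension: the projective dimensions of all right `A`-modules are bounded
by some natural number. -/
def HasFiniteGlobalDim (A : Type w) [Ring A] : Prop :=
  ∃ n : ℕ, ∀ V : ModuleCat.{w} Aᵐᵒᵖ, CategoryTheory.HasProjectiveDimensionLE V n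

/-- The subgroup of `M ⊗[ℤ] N` generated by all `(m · a) ⊗ n - m ⊗ (a n)`. -/
def balancedRelations (A : Type w) (M : Type u) (N : Type v) [Ring A]
    [AddCommGroup M] [Module Aᵐᵒᵖ M] [AddCommGroup N] [Module A N] : AddSubgroup (M ⊗[ℤ] N) :=
  AddSubgroup.closure
    {t | ∃ (m : M) (a : A) (n : N), t = (MulOpposite.op a • m) ⊗ₜ[ℤ] n - m ⊗ₜ[ℤ] (a • n)}

/-- The tensor product `M ⊗_A N` of a right and a left module over a noncommutative ring `A`. -/
abbrev BalancedTensor (A : Type w) (M : Type u) (N : Type v) [Ring A]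
    [AddCommGroup M] [Module Aᵐᵒᵖ M] [AddCommGroup N] [Module A N] : Type (max u v) :=
  (M ⊗[ℤ] N) ⧸ balancedRelations A M N

/-- The map `M ⊗_A f : M ⊗_A N → M ⊗_A N'` induced by an `A`-linear map `f : N → N'`. -/
noncomputable def BalancedTensor.lTensor {A : Type w} (M : Type u) {N N' : Type v} [Ring A]
    [AddCommGroup M] [Module Aᵐᵒᵖ M] [AddCommGroup N] [Module A N] [AddCommGroup N'] [Module A N']
    (f : N →ₗ[A] N') : BalancedTensor A M N →+ BalancedTensor A M N' :=
  QuotientAddGroup.map _ _ (LinearMap.lTensor M f.toAddMonoidHom.toIntLinearMap).toAddMonoidHom (by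
    refine (AddSubgroup.closure_le _).2 ?_
    rintro _ ⟨m, a, n, rfl⟩
    refine AddSubgroup.subset_closure ⟨m, a, f n, ?_⟩
    rw [map_sub]
    exact congrArg (fun y => (MulOpposite.op a • m) ⊗ₜ[ℤ] (f n) - m ⊗ₜ[ℤ] y) (map_smul f a n))

/-- A right `A`-module `M` is flat: `M ⊗_A -` preserves injectivity of maps of left modules. -/
def IsFlatRightModule (A : Type w) (M : Type u) [Ring A] [AddCommGroup M] [Module Aᵐᵒᵖ M] : Prop :=
  ∀ (N N' : Type w) [AddCommGroup N] [Module A N] [AddCommGroup N'] [Module A N']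
    (f : N →ₗ[A] N'), Function.Injective f → Function.Injective (BalancedTensor.lTensor M f)

/-- The right `A`-module `V` has flat dimension at most `n`: there is an exact sequence
`0 → F_n → ⋯ → F_0 → V → 0` with all `F_i` flat. -/
def FlatDimLE (A : Type w) [Ring A] :
    ℕ → ∀ (V : Type w) [AddCommGroup V] [Module Aᵐᵒᵖ V], Prop
  | 0, V, _, _ => IsFlatRightModule A V
  | n + 1, V, _, _ => ∃ (F : Type w) (_ : AddCommGroup F) (_ : Module Aᵐᵒᵖ F)
      (p : F →ₗ[Aᵐᵒᵖ] V), IsFlatRightModule A F ∧ Function.Surjective p ∧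
        FlatDimLE A n (LinearMap.ker p)

/-- Finite weak dimension: the flat dimensions of all right `A`-modules are bounded by some natural
number. -/
def HasFiniteWeakDim (A : Type w) [Ring A] : Prop :=
  ∃ n : ℕ, ∀ (V : Type w) [AddCommGroup V] [Module Aᵐᵒᵖ V], FlatDimLE A n V

end Ring

section Hopf

variable (k : Type u) (H : Type v) [Field k] [Ring H] [HopfAlgebra k H]

/-- A right `H`-comodule structure on the vector space `M`. -/
structure RightComodule (M : Type x) [AddCommGroup M] [Module k M] where
  /-- the coaction `m ↦ ∑ m₍₀₎ ⊗ m₍₁₎` -/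
  coact : M →ₗ[k] M ⊗[k] H
  coassoc : ∀ m : M, TensorProduct.assoc k M H H (coact.rTensor H (coact m)) =
    (Coalgebra.comul (R := k) (A := H)).lTensor M (coact m)
  counit : ∀ m : M, TensorProduct.rid k M
    ((Coalgebra.counit (R := k) (A := H)).lTensor M (coact m)) = m

/-- A right `H`-comodule algebra structure on the algebra `A`: a right comodule structure whose
coaction `A → A ⊗ H` is a homomorphism of (unital) algebras. -/
structure RightComoduleAlgebra (A : Type w) [Ring A] [Algebra k A] extends
    RightComodule k H A where
  coact_one : coact 1 = 1
  coact_mul : ∀ a b : A, coact (a * b) = coact a * coact b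

variable {k H}

/-- A subspace `U` of a right `H`-comodule `M` is a subcomodule: the coaction maps `U` into `U ⊗ H`,
regarded as a subspace of `M ⊗ H`. -/
def RightComodule.IsSubcomodule {M : Type x} [AddCommGroup M] [Module k M]
    (ρ : RightComodule k H M) (U : Submodule k M) : Prop :=
  ∀ m ∈ U, ρ.coact m ∈ LinearMap.range (U.subtype.rTensor H)

/-- `A` is a simple object of the category of left `A`-modules with a compatible right
`H`-coaction: it is nonzero and has no nonzero proper left ideal stable under the coaction. -/
def RightComoduleAlgebra.IsSimpleLeftHopf {A : Type w} [Ring A] [Algebra k A]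
    (ρ : RightComoduleAlgebra k H A) : Prop :=
  Nontrivial A ∧ ∀ I : Submodule A A,
    ρ.toRightComodule.IsSubcomodule (I.restrictScalars k) → I = ⊥ ∨ I = ⊤

/-- The action `(m, a) ↦ m · a` of `A` on a right `A`-module as a `k`-bilinear map. -/
def rightAction (k : Type u) (A : Type w) (M : Type x) [Field k] [Ring A] [Algebra k A]
    [AddCommGroup M] [Module k M] [Module Aᵐᵒᵖ M] [IsScalarTower k Aᵐᵒᵖ M] :
    M →ₗ[k] A →ₗ[k] M :=
  haveI : SMulCommClass k Aᵐᵒᵖ M := IsScalarTower.to_smulCommClass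
  LinearMap.mk₂ k (fun m a => MulOpposite.op a • m)
    (fun m m' a => smul_add _ m m')
    (fun c m a => (smul_comm c (MulOpposite.op a) m).symm)
    (fun m a b => by rw [MulOpposite.op_add, add_smul])
    (fun c m a => by rw [MulOpposite.op_smul, smul_assoc])

/-- The right action of the algebra `A ⊗ H` on `M ⊗ H`, for a right `A`-module `M`:
`(m ⊗ h) · (a ⊗ g) = (m · a) ⊗ (h g)`. -/
noncomputable def tensorRightAction (k : Type u) (H : Type v) (A : Type w) (M : Type x) [Field k]
    [Ring H] [Algebra k H] [Ring A] [Algebra k A]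
    [AddCommGroup M] [Module k M] [Module Aᵐᵒᵖ M] [IsScalarTower k Aᵐᵒᵖ M] :
    M ⊗[k] H →ₗ[k] A ⊗[k] H →ₗ[k] M ⊗[k] H :=
  TensorProduct.map₂ (rightAction k A M) (LinearMap.mul k H)

/-- The structure of a right Hopf module on a right `A`-module `M`: a right `H`-comodule structure
such that `∑ (m a)₍₀₎ ⊗ (m a)₍₁₎ = ∑ m₍₀₎ a₍₀₎ ⊗ m₍₁₎ a₍₁₎`. -/
structure RightHopfModule {A : Type w} [Ring A] [Algebra k A] (ρ : RightComoduleAlgebra k H A)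
    (M : Type x) [AddCommGroup M] [Module k M] [Module Aᵐᵒᵖ M] [IsScalarTower k Aᵐᵒᵖ M] extends
    RightComodule k H M where
  coact_smul : ∀ (m : M) (a : A),
    coact (MulOpposite.op a • m) = tensorRightAction k H A M (coact m) (ρ.coact a)

end Hopf

end HopfMod

/-!
A Hopf module is the directed union of its finitely generated Hopf submodules, and a maximality
argument reduces the claim to finitely generated Hopf modules
(`RightHopfModule.projective_of_forall_finite`). Such a Hopf module `P` is generated by a
finite-dimensional subcomodule `C`, hence a quotient of the Hopf module `A ⊗ C`, which is free of
finite rank (`RightHopfModule.exists_free_cover`). So `P` is projective as soon as finitely generated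
Hopf submodules of `Aⁿ` are direct summands and satisfy the ascending chain condition: the kernel of
`Aⁿ → P` is then itself finitely generated (`RightHopfModule.projective_of_finite`).

Let `A` be semiprime Goldie. For a finitely generated Hopf submodule `N` of `Aⁿ`, the left Hopf module
`E = coker (Hom(Aⁿ, A) → Hom(N, A))` is torsion, because over the classical quotient ring, which is
semisimple, all homomorphisms extend. Given `v ∈ E`, the `a ∈ A` with `ρ(a) (v ⊗ 1) = 0` form a left
ideal stable under the coaction; it is not zero, as it contains the `a` with `a v₍₀₎ ⊗ v₍₁₎ = 0`, and
so it contains `1` because `A` is simple. Hence `E = 0` (`RightHopfModule.IsHopfSub.exists_extension`),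
and `N` is a direct summand of `Aⁿ` whenever it is projective. That `N` is projective follows by
induction on its flat dimension, since finitely presented flat modules are projective and by coherence
the syzygies of `N` are finitely presented
(`RightHopfModule.IsHopfSub.projective_of_charDimLE`). A strictly increasing chain of direct summands
of `Aⁿ` would contradict finite uniform dimension. The Noetherian case is a special case of this.

Flat dimension is measured by the injective dimension of character modules (`CharDimLE`), for which
Mathlib provides dimension shifting, and the quotient ring is avoided: it suffices that each
homomorphism `N → A` extends after multiplication by the elements of an essential left ideal
(`isEssentialSubmodule_extensionIdeal`).

If `A` is von Neumann regular, finitely generated submodules of `Aⁿ` are always direct summands. For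
Hopf submodules `N < N'` of this kind, `Y = N' / N` is a nonzero projective Hopf module. Its trace
ideal is stable under the coaction and nonzero, and so equal to `A`; therefore `Y ≠ Y J` for each
proper ideal `J`. If `A / J` is simple Artinian, then the images of `N` and `N'` in `(A / J)ⁿ` are
different, and this gives the chain condition (`IsVonNeumannRegular.not_strictMono`).
-/

namespace HopfMod

universe w x

/-! ### Uniform dimension and essential submodules -/

section UniformDim

variable {R : Type*} [Ring R] {M M' : Type*} [AddCommGroup M] [Module R M]
  [AddCommGroup M'] [Module R M']

theorem iSupIndep_of_disjoint_iSup_gt {ι : Type*} [LinearOrder ι] {X : ι → Submodule R M}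
    (h : ∀ i, Disjoint (X i) (⨆ j > i, X j)) : iSupIndep X := by
  rw [iSupIndep_iff_finsetSum_eq_zero_imp_eq_zero]
  intro s
  refine Finset.induction_on_min s (by simp) fun a s ha ih => ?_
  · intro v hv hsum
    have has : a ∉ s := fun h' => lt_irrefl _ (ha a h')
    rw [Finset.sum_insert has] at hsum
    have h1 : ∑ i ∈ s, v i ∈ ⨆ j > a, X j :=
      Submodule.sum_mem _ fun i hi => (le_iSup₂_of_le i (ha i hi) le_rfl :
        X i ≤ ⨆ j > a, X j) (hv i (Finset.mem_insert_of_mem hi))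
    have h2 : v a ∈ ⨆ j > a, X j := by
      rw [eq_neg_of_add_eq_zero_left hsum]
      exact neg_mem h1
    have h0 : v a = 0 := Submodule.disjoint_def.1 (h a) _ (hv a (Finset.mem_insert_self _ _)) h2
    rw [h0, zero_add] at hsum
    intro i hi
    rcases Finset.mem_insert.1 hi with rfl | hi
    · exact h0
    · exact ih v (fun i hi => hv i (Finset.mem_insert_of_mem hi)) hsum i hi

theorem iSupIndep_of_antitone {X D : ℕ → Submodule R M} (hX : ∀ i, X i ≤ D i)
    (hD : ∀ i, D (i + 1) ≤ D i) (h : ∀ i, Disjoint (X i) (D (i + 1))) : iSupIndep X := by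
  refine iSupIndep_of_disjoint_iSup_gt fun i => (h i).mono_right ?_
  exact iSup₂_le fun j hj => (hX j).trans (antitone_nat_of_succ_le hD hj)

theorem iSupIndep_of_monotone {X K : ℕ → Submodule R M} (hX : ∀ i, X i ≤ K (i + 1))
    (hK : ∀ i, K i ≤ K (i + 1)) (h : ∀ i, Disjoint (X i) (K i)) : iSupIndep X := by
  refine iSupIndep_of_disjoint_iSup_gt (ι := ℕᵒᵈ) fun i => (h i).mono_right ?_
  exact iSup₂_le fun j hj => (hX j).trans (monotone_nat_of_le_succ hK (Nat.succ_le_of_lt hj))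

theorem HasFiniteUniformDim.of_injective (h : HasFiniteUniformDim R M') (f : M →ₗ[R] M')
    (hf : Function.Injective f) : HasFiniteUniformDim R M := by
  rintro ⟨X, hX, hi⟩
  refine h ⟨fun i => (X i).map f, fun i => ?_, ?_⟩
  · rw [Ne, ← (Submodule.map_bot f : _), (Submodule.map_injective_of_injective hf).eq_iff]
    exact hX i
  · refine iSupIndep_of_disjoint_iSup_gt fun i => ?_
    have : (⨆ j > i, (X j).map f) = (⨆ j > i, X j).map f := by simp [Submodule.map_iSup]
    rw [this]
    exact Submodule.disjoint_map hf ((hi i).mono_right (iSup₂_mono' fun j hj => ⟨j, ne_of_gt hj, le_rfl⟩))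

/-- An infinite direct sum in `M` has either a tail which embeds under `f`, or infinitely many
finite blocks which meet `ker f`. -/
theorem HasFiniteUniformDim.of_ker (f : M →ₗ[R] M')
    (h : HasFiniteUniformDim R (LinearMap.ker f)) (h' : HasFiniteUniformDim R M') :
    HasFiniteUniformDim R M := by
  rintro ⟨X, hX, hi⟩
  by_cases hc : ∃ i, Disjoint (⨆ l ≥ i, X l) (LinearMap.ker f)
  · obtain ⟨i, hi'⟩ := hc
    have hinj : Set.InjOn f (⨆ l ≥ i, X l : Submodule R M) :=
      LinearMap.injOn_of_disjoint_ker le_rfl hi'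
    have hle : ∀ l, X (i + l) ≤ ⨆ l ≥ i, X l := fun l =>
      le_iSup₂_of_le (i + l) (Nat.le_add_right i l) le_rfl
    refine h' ⟨fun l => (X (i + l)).map f, fun l hl => hX (i + l) ?_, ?_⟩
    · rw [eq_bot_iff]
      intro y hy
      have : f y ∈ (X (i + l)).map f := Submodule.mem_map_of_mem hy
      rw [show (X (i + l)).map f = ⊥ from hl, Submodule.mem_bot] at this
      exact hinj (hle l hy) (zero_mem _) (by simpa using this)
    · refine iSupIndep_of_disjoint_iSup_gt fun l => ?_
      have h1 : (⨆ j > l, (X (i + j)).map f) = (⨆ j > l, X (i + j)).map f := by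
        simp [Submodule.map_iSup]
      have h2 : Disjoint (X (i + l)) (⨆ j > l, X (i + j)) :=
        (hi (i + l)).mono_right (iSup₂_le fun j hj =>
          le_iSup₂_of_le (f := fun j (_ : j ≠ i + l) => X j) (i + j)
            (by have : l < j := hj; omega) le_rfl)
      rw [h1, Submodule.disjoint_def]
      rintro _ ⟨y, hy, rfl⟩ ⟨z, hz, hzy⟩
      have hz' : z ∈ ⨆ l ≥ i, X l := (iSup₂_le fun j _ => hle j : (⨆ j > l, X (i + j)) ≤ _) hz
      have hyz : z = y := hinj hz' (hle l hy) hzy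
      subst hyz
      rw [Submodule.disjoint_def.1 h2 z hy hz, map_zero]
  · push Not at hc
    have key : ∀ i, ∃ j, ∃ x ∈ (⨆ l ∈ Finset.Ico i j, X l), x ∈ LinearMap.ker f ∧ x ≠ 0 := by
      intro i
      have := hc i
      rw [Submodule.disjoint_def] at this
      push Not at this
      obtain ⟨x, hx, hxk, hx0⟩ := this
      have hmono : Monotone fun j => (⨆ l ∈ Finset.Ico i j, X l) := fun a b hab =>
        biSup_mono fun l hl => by simp only [Finset.mem_Ico] at hl ⊢; omega
      have hle : (⨆ l ≥ i, X l) ≤ ⨆ j, ⨆ l ∈ Finset.Ico i j, X l :=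
        iSup₂_le fun l hl => le_iSup_of_le (l + 1)
          (le_iSup₂_of_le (f := fun l (_ : l ∈ Finset.Ico i _) => X l) l
            (by simp only [Finset.mem_Ico]; omega) le_rfl)
      obtain ⟨j, hj⟩ := (Submodule.mem_iSup_of_directed _ hmono.directed_le).1 (hle hx)
      exact ⟨j, x, hj, hxk, hx0⟩
    choose j y hy hyk hy0 using key
    have hj : ∀ i, i < j i := by
      intro i
      by_contra hlt
      have hemp : Finset.Ico i (j i) = ∅ := Finset.Ico_eq_empty hlt
      have := hy i
      rw [hemp] at this
      simp at this
      exact hy0 i this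
    let t : ℕ → ℕ := fun n => j^[n] 0
    have ht : ∀ n, t (n + 1) = j (t n) := fun n => Function.iterate_succ_apply' _ _ _
    have hy0' : ∀ n, y (t n) ≠ 0 := fun n => hy0 _
    refine h ⟨fun n => (⨆ l ∈ Finset.Ico (t n) (t (n + 1)), X l).comap (LinearMap.ker f).subtype,
      fun n hn => hy0' n ?_, ?_⟩
    · have : (⟨y (t n), hyk _⟩ : LinearMap.ker f) ∈
          (⨆ l ∈ Finset.Ico (t n) (t (n + 1)), X l).comap (LinearMap.ker f).subtype := by
        rw [Submodule.mem_comap, ht]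
        exact hy (t n)
      exact congrArg Subtype.val ((Submodule.mem_bot R).1 (hn.le this))
    · refine iSupIndep_of_antitone (D := fun n => (⨆ l ≥ t n, X l).comap (LinearMap.ker f).subtype)
        (fun n => Submodule.comap_mono ?_) (fun n => Submodule.comap_mono ?_) fun n => ?_
      · exact biSup_mono fun l hl => (Finset.mem_Ico.1 hl).1
      · have := (hj (t n)).le
        rw [← ht] at this
        exact biSup_mono fun l hl => this.trans hl
      · have hd : Disjoint (⨆ l ∈ Finset.Ico (t n) (t (n + 1)), X l) (⨆ l ≥ t (n + 1), X l) := by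
          have := hi.disjoint_biSup_biSup (s := {l | l ∈ Finset.Ico (t n) (t (n + 1))})
            (t := {l | l ≥ t (n + 1)}) (by
              rw [Set.disjoint_left]
              intro l hl hl'
              simp only [Finset.mem_Ico, Set.mem_ofPred_eq] at hl hl'
              omega)
          simpa using this
        rw [Submodule.disjoint_def]
        intro z hz hz'
        exact Subtype.ext (Submodule.disjoint_def.1 hd z.1 hz hz')

theorem HasFiniteUniformDim.pi_fin (h : HasFiniteUniformDim R M) (n : ℕ) :
    HasFiniteUniformDim R (Fin n → M) := by
  induction n with
  | zero =>
    rintro ⟨X, hX, -⟩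
    exact hX 0 (Subsingleton.elim _ _)
  | succ n ih =>
    refine HasFiniteUniformDim.of_ker (LinearMap.proj (0 : Fin (n + 1))) ?_ h
    refine ih.of_injective (((LinearMap.funLeft R M Fin.succ)).comp (Submodule.subtype _)) ?_
    rw [injective_iff_map_eq_zero]
    intro v hv
    ext i
    refine Fin.cases ?_ (fun i => ?_) i
    · exact v.2
    · exact congrFun hv i

theorem hasFiniteUniformDim_of_isNoetherian [IsNoetherian R M] : HasFiniteUniformDim R M := by
  rintro ⟨X, hX, hi⟩
  exact Set.infinite_univ (α := ℕ)
    ((WellFoundedGT.finite_ne_bot_of_iSupIndep hi).subset fun i _ => hX i)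

/-- The submodule `N` of `M` meets every nonzero submodule of `M`. -/
def IsEssentialSubmodule (N : Submodule R M) : Prop :=
  ∀ U : Submodule R M, Disjoint U N → U = ⊥

theorem IsEssentialSubmodule.mono {N N' : Submodule R M} (h : IsEssentialSubmodule N)
    (hN : N ≤ N') : IsEssentialSubmodule N' :=
  fun U hU => h U (hU.mono_right hN)

theorem IsEssentialSubmodule.inf {N N' : Submodule R M} (h : IsEssentialSubmodule N)
    (h' : IsEssentialSubmodule N') : IsEssentialSubmodule (N ⊓ N') := by
  intro U hU
  refine h U (disjoint_iff.2 (h' _ ?_))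
  rwa [disjoint_iff, inf_assoc, ← disjoint_iff]

theorem IsEssentialSubmodule.iInf {ι : Type*} [Finite ι] {N : ι → Submodule R M}
    (h : ∀ i, IsEssentialSubmodule (N i)) : IsEssentialSubmodule (⨅ i, N i) := by
  have := Fintype.ofFinite ι
  rw [← Finset.inf_univ_eq_iInf]
  exact Finset.inf_induction (p := IsEssentialSubmodule) (fun U hU => by simpa using hU)
    (fun _ h₁ _ h₂ => h₁.inf h₂) fun i _ => h i

theorem IsEssentialSubmodule.comap {N : Submodule R M'} (h : IsEssentialSubmodule N)
    (f : M →ₗ[R] M') : IsEssentialSubmodule (N.comap f) := by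
  intro U hU
  have h1 : U.map f = ⊥ := by
    refine h _ ?_
    rw [Submodule.disjoint_def]
    rintro _ ⟨y, hy, rfl⟩ hN
    rw [Submodule.disjoint_def.1 hU y hy hN, map_zero]
  exact eq_bot_iff.2 (hU le_rfl ((Submodule.map_le_iff_le_comap.1 h1.le).trans
    (Submodule.comap_mono bot_le)))

/-- If `U` avoids the image of `f`, then the modules `f ^ i (U)` form a direct sum. -/
theorem HasFiniteUniformDim.isEssentialSubmodule_range (h : HasFiniteUniformDim R M)
    (f : M →ₗ[R] M) (hf : Function.Injective f) : IsEssentialSubmodule (LinearMap.range f) := by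
  intro U hU
  by_contra hU0
  have hinj : ∀ i : ℕ, Function.Injective (f ^ i) := fun i => by
    rw [Module.End.coe_pow]; exact hf.iterate i
  refine h ⟨fun i => U.map (f ^ i), fun i => ?_, iSupIndep_of_antitone
    (D := fun i => LinearMap.range (f ^ i)) (fun i => LinearMap.map_le_range) (fun i => ?_)
    fun i => ?_⟩
  · rwa [Ne, ← Submodule.map_bot (f ^ i), (Submodule.map_injective_of_injective (hinj i)).eq_iff]
  · rw [pow_succ]
    exact LinearMap.range_comp_le_range _ _
  · have : LinearMap.range (f ^ (i + 1)) = (LinearMap.range f).map (f ^ i) := by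
      rw [pow_succ]
      exact LinearMap.range_comp _ _
    rw [this]
    exact Submodule.disjoint_map (hinj i) hU

theorem exists_isEssentialSubmodule_sup (N : Submodule R M) :
    ∃ X : Submodule R M, Disjoint N X ∧ IsEssentialSubmodule (N ⊔ X) := by
  obtain ⟨X, -, hX⟩ := zorn_le_nonempty₀ {X : Submodule R M | Disjoint N X} (by
    intro c hc hchain y hy
    exact ⟨sSup c, (hchain.directedOn.disjoint_sSup_right).2 fun b hb => hc hb,
      fun z hz => le_sSup hz⟩) ⊥ disjoint_bot_right
  refine ⟨X, hX.prop, fun U hU => ?_⟩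
  have h1 : Disjoint N (X ⊔ U) := hX.prop.disjoint_sup_right_of_disjoint_sup_left hU.symm
  have h2 : U ≤ X := le_sup_right.trans (hX.le_of_ge h1 le_sup_left)
  exact eq_bot_iff.2 (hU le_rfl (h2.trans le_sup_right))

end UniformDim

/-! ### Goldie's theorem on regular elements -/

section Goldie

variable {A : Type w} [Ring A]

/-- Left multiplication by `z`, as an endomorphism of the right module `A`. -/
def leftMul (z : A) : A →ₗ[Aᵐᵒᵖ] A := DistribSMul.toLinearMap Aᵐᵒᵖ A z

@[simp] theorem leftMul_apply (z a : A) : leftMul z a = z * a := rfl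

theorem mem_ker_leftMul {z a : A} : a ∈ LinearMap.ker (leftMul z) ↔ z * a = 0 := Iff.rfl

theorem isRightAnnihilator_ker_leftMul (z : A) :
    IsRightAnnihilator (LinearMap.ker (leftMul z)) :=
  ⟨{z}, fun a => by simp⟩

theorem ker_leftMul_le_mul (x z : A) :
    LinearMap.ker (leftMul z) ≤ LinearMap.ker (leftMul (x * z)) := by
  intro a ha
  rw [mem_ker_leftMul] at ha ⊢
  rw [mul_assoc, ha, mul_zero]

theorem exists_pow_ker_eq (hacc : ∀ I : ℕ →o Submodule Aᵐᵒᵖ A,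
      (∀ n, IsRightAnnihilator (I n)) → ∃ n, ∀ m, n ≤ m → I n = I m) (z : A) :
    ∃ n, 0 < n ∧ ∀ r, z ^ n * (z ^ n * r) = 0 → z ^ n * r = 0 := by
  obtain ⟨n, hn⟩ := hacc ⟨fun n => LinearMap.ker (leftMul (z ^ n)),
    monotone_nat_of_le_succ fun n => by
      rw [pow_succ']
      exact ker_leftMul_le_mul _ _⟩ fun n => isRightAnnihilator_ker_leftMul _
  have hn1 : LinearMap.ker (leftMul (z ^ n)) = LinearMap.ker (leftMul (z ^ (n + 1))) :=
    hn (n + 1) (by omega)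
  have hn2 : LinearMap.ker (leftMul (z ^ n)) = LinearMap.ker (leftMul (z ^ (n + 1 + (n + 1)))) :=
    hn (n + 1 + (n + 1)) (by omega)
  refine ⟨n + 1, n.succ_pos, fun r hr => ?_⟩
  have : r ∈ LinearMap.ker (leftMul (z ^ (n + 1 + (n + 1)))) := by
    rw [mem_ker_leftMul, pow_add, mul_assoc, hr]
  rwa [← hn2, hn1] at this

/-- Utumi's argument: among the nonzero elements of a nil left ideal `Aa`, one with maximal right
annihilator generates an ideal of square zero. -/
theorem exists_mul_not_isNilpotent (hs : IsSemiprimeRing A) (hacc : ∀ I : ℕ →o Submodule Aᵐᵒᵖ A,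
      (∀ n, IsRightAnnihilator (I n)) → ∃ n, ∀ m, n ≤ m → I n = I m) {a : A} (ha : a ≠ 0) :
    ∃ x : A, ¬ IsNilpotent (x * a) := by
  by_contra! hnil
  have hwf : WellFoundedGT {I : Submodule Aᵐᵒᵖ A // IsRightAnnihilator I} := by
    rw [wellFoundedGT_iff_monotone_chain_condition]
    intro I
    obtain ⟨n, hn⟩ := hacc ⟨fun n => (I n).1, fun i j hij => I.monotone hij⟩ fun n => (I n).2
    exact ⟨n, fun m hm => Subtype.ext (hn m hm)⟩
  let S : Set {I : Submodule Aᵐᵒᵖ A // IsRightAnnihilator I} :=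
    {I | ∃ x : A, x * a ≠ 0 ∧ I.1 = LinearMap.ker (leftMul (x * a))}
  obtain ⟨I, ⟨y, hy0, hI⟩, hmax⟩ := hwf.wf.has_min S
    ⟨⟨_, isRightAnnihilator_ker_leftMul a⟩, 1, by simpa using ha, by simp⟩
  have hmax' : ∀ x : A, x * (y * a) ≠ 0 → ∀ r, x * (y * a) * r = 0 → y * a * r = 0 := by
    intro x hx r hr
    have hle : I ≤ ⟨_, isRightAnnihilator_ker_leftMul (x * (y * a))⟩ := by
      change I.1 ≤ _
      rw [hI]
      exact ker_leftMul_le_mul _ _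
    have h2 := hmax ⟨_, isRightAnnihilator_ker_leftMul (x * (y * a))⟩
      ⟨x * y, by rwa [mul_assoc], by rw [mul_assoc]⟩
    have h3 : ⟨_, isRightAnnihilator_ker_leftMul (x * (y * a))⟩ ≤ I := by
      by_contra hlt
      exact h2 (lt_of_le_not_ge hle hlt)
    have h4 : r ∈ I.1 := h3 (mem_ker_leftMul.2 hr)
    rwa [hI] at h4
  refine hy0 (hs _ fun x => ?_)
  have hx := hnil (x * y)
  rw [mul_assoc] at hx
  by_cases h0 : x * (y * a) = 0
  · rw [mul_assoc, h0, mul_zero]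
  have hn := pow_nilpotencyClass hx
  have hpos : 1 < nilpotencyClass (x * (y * a)) := by
    by_contra hlt
    interval_cases h : nilpotencyClass (x * (y * a))
    · rw [pow_zero] at hn
      exact h0 (by rw [← mul_one (x * (y * a)), hn, mul_zero])
    · exact h0 (by simpa using hn)
  obtain ⟨m, hm⟩ : ∃ m, nilpotencyClass (x * (y * a)) = m + 2 :=
    ⟨_, (Nat.sub_add_cancel hpos).symm⟩
  have : Nontrivial A := ⟨_, _, ha⟩
  have hne : (x * (y * a)) ^ (m + 1) ≠ 0 := by
    have := pow_pred_nilpotencyClass hx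
    rwa [hm] at this
  rw [hm] at hn
  have := hmax' ((x * (y * a)) ^ m * x) (by rwa [mul_assoc, ← pow_succ]) (x * (y * a))
    (by rw [mul_assoc _ x, ← pow_succ, ← pow_succ, hn])
  rw [mul_assoc (y * a)]
  exact this

/-- The right singular ideal of a semiprime right Goldie ring is zero. -/
theorem eq_zero_of_mul_essential_eq_zero (hs : IsSemiprimeRing A) (hacc : ∀ I : ℕ →o Submodule Aᵐᵒᵖ A,
      (∀ n, IsRightAnnihilator (I n)) → ∃ n, ∀ m, n ≤ m → I n = I m)
    {J : Submodule Aᵐᵒᵖ A} (hJ : IsEssentialSubmodule J) {z : A} (hz : ∀ r ∈ J, z * r = 0) :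
    z = 0 := by
  by_contra hz0
  obtain ⟨x, hx⟩ := exists_mul_not_isNilpotent hs hacc hz0
  obtain ⟨n, hn, hker⟩ := exists_pow_ker_eq hacc (x * z)
  refine hx ⟨n, ?_⟩
  have h1 : LinearMap.range (leftMul ((x * z) ^ n)) = ⊥ := by
    refine hJ _ ?_
    rw [Submodule.disjoint_def]
    rintro _ ⟨r, rfl⟩ hr
    refine hker r ?_
    obtain ⟨m, rfl⟩ : ∃ m, n = m + 1 := ⟨n - 1, by omega⟩
    rw [leftMul_apply] at hr
    rw [pow_succ (x * z), mul_assoc _ (x * z), mul_assoc x, ← pow_succ, hz _ hr, mul_zero, mul_zero]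
  have : leftMul ((x * z) ^ n) 1 ∈ LinearMap.range (leftMul ((x * z) ^ n)) := ⟨1, rfl⟩
  rw [h1, Submodule.mem_bot] at this
  simpa using this

/-- In a semiprime right Goldie ring, an essential right ideal contains an element `d` with zero
right annihilator: starting from `c = 0`, elements of `J` which annihilate on the right the ones
already found are added up as long as the sum `c` has a nonzero right annihilator; this yields a
direct sum of right ideals and therefore comes to an end. -/
theorem exists_mem_essential_mul_eq_zero (hs : IsSemiprimeRing A) (hG : IsRightGoldie A)
    {J : Submodule Aᵐᵒᵖ A} (hJ : IsEssentialSubmodule J) :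
    ∃ d ∈ J, ∀ r, d * r = 0 → r = 0 := by
  obtain ⟨hdim, hacc⟩ := hG
  by_contra! hno
  have step : ∀ s : {c : A // c ∈ J ∧ ∀ r, c * (c * r) = 0 → c * r = 0},
      ∃ s' : {c : A // c ∈ J ∧ ∀ r, c * (c * r) = 0 → c * r = 0}, ∃ u : A, u ≠ 0 ∧ s.1 * u = 0 ∧
        (∀ r, s'.1 * r = 0 → s.1 * r = 0) ∧ ∀ r, s'.1 * (u * r) = 0 → u * r = 0 := by
    rintro ⟨c, hcJ, hc⟩
    obtain ⟨r, hr, hr0⟩ := hno c hcJ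
    have h1 : LinearMap.ker (leftMul c) ⊓ J ≠ ⊥ := fun h => by
      have hbot := hJ _ (disjoint_iff.2 h)
      have : r ∈ LinearMap.ker (leftMul c) := hr
      rw [hbot] at this
      exact hr0 this
    obtain ⟨v, ⟨hvc, hvJ⟩, hv0⟩ := Submodule.exists_mem_ne_zero_of_ne_bot h1
    rw [SetLike.mem_coe, mem_ker_leftMul] at hvc
    obtain ⟨x, hx⟩ := exists_mul_not_isNilpotent hs hacc hv0
    obtain ⟨n, hn, hker⟩ := exists_pow_ker_eq hacc (v * x)
    obtain ⟨m, rfl⟩ : ∃ m, n = m + 1 := ⟨n - 1, by omega⟩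
    set u := (v * x) ^ (m + 1) with hu
    have hu0 : u ≠ 0 := by
      intro h
      refine hx ⟨m + 2, ?_⟩
      rw [pow_succ, ← mul_assoc, mul_pow_mul, ← hu, h, mul_zero, zero_mul]
    have huv : u = v * (x * (v * x) ^ m) := by rw [hu, pow_succ', mul_assoc]
    have hcu : c * u = 0 := by rw [huv, ← mul_assoc, hvc, zero_mul]
    have huJ : u ∈ J := by
      rw [huv]
      exact J.smul_mem (MulOpposite.op (x * (v * x) ^ m)) hvJ
    have hker' : ∀ r, (c + u) * r = 0 → c * r = 0 ∧ u * r = 0 := by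
      intro r hr
      have h2 : c * (c * r) = 0 := by
        have h3 : c * ((c + u) * r) = 0 := by rw [hr, mul_zero]
        rwa [add_mul, mul_add, ← mul_assoc c u, hcu, zero_mul, add_zero] at h3
      have h4 := hc r h2
      exact ⟨h4, by rwa [add_mul, h4, zero_add] at hr⟩
    refine ⟨⟨c + u, J.add_mem hcJ huJ, fun r hr => ?_⟩, u, hu0, hcu, fun r hr => (hker' r hr).1,
      fun r hr => hker r (hker' _ hr).2⟩
    obtain ⟨h5, h6⟩ := hker' _ hr
    have h7 : c * r = 0 := by
      refine hc r ?_
      rwa [add_mul, mul_add, ← mul_assoc c u, hcu, zero_mul, add_zero] at h5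
    have h8 : u * r = 0 := by
      refine hker r ?_
      rwa [add_mul, h7, zero_add] at h6
    rw [add_mul, h7, h8, add_zero]
  choose f u hu0 hcu hmono hdisj using step
  let c : ℕ → {c : A // c ∈ J ∧ ∀ r, c * (c * r) = 0 → c * r = 0} :=
    fun n => f^[n] ⟨0, J.zero_mem, by simp⟩
  have hc : ∀ n, c (n + 1) = f (c n) := fun n => Function.iterate_succ_apply' _ _ _
  refine hdim ⟨fun n => LinearMap.range (leftMul (u (c n))), fun n hn => hu0 (c n) ?_,
    iSupIndep_of_antitone (D := fun n => LinearMap.ker (leftMul (c n).1)) (fun n => ?_)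
      (fun n r hr => ?_) fun n => ?_⟩
  · have : leftMul (u (c n)) 1 ∈ LinearMap.range (leftMul (u (c n))) := ⟨1, rfl⟩
    have := hn.le this
    simpa using this
  · rintro _ ⟨r, rfl⟩
    rw [mem_ker_leftMul, leftMul_apply, ← mul_assoc, hcu, zero_mul]
  · rw [hc] at hr
    exact hmono _ r hr
  · rw [Submodule.disjoint_def, hc]
    rintro _ ⟨r, rfl⟩ hr
    exact hdisj _ r hr

/-- In a semiprime right Goldie ring with finite left uniform dimension, an essential right ideal
contains an element `d`, with zero left and right annihilators, such that `dA` and `Ad` are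
essential. -/
theorem exists_regular_mem_essential (hs : IsSemiprimeRing A) (hG : IsRightGoldie A)
    (hl : HasFiniteUniformDim A A) {J : Submodule Aᵐᵒᵖ A} (hJ : IsEssentialSubmodule J) :
    ∃ d ∈ J, IsEssentialSubmodule (LinearMap.range (leftMul d)) ∧
      IsEssentialSubmodule (LinearMap.range (LinearMap.toSpanSingleton A A d)) := by
  obtain ⟨d, hdJ, hd⟩ := exists_mem_essential_mul_eq_zero hs hG hJ
  have h1 : IsEssentialSubmodule (LinearMap.range (leftMul d)) :=
    hG.1.isEssentialSubmodule_range _ ((injective_iff_map_eq_zero _).2 hd)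
  refine ⟨d, hdJ, h1, hl.isEssentialSubmodule_range _ ((injective_iff_map_eq_zero _).2
    fun z hz => eq_zero_of_mul_essential_eq_zero hs hG.2 h1 ?_)⟩
  rintro _ ⟨r, rfl⟩
  rw [leftMul_apply, ← mul_assoc]
  rw [LinearMap.toSpanSingleton_apply, smul_eq_mul] at hz
  rw [hz, zero_mul]

/-- The left ideal of all `a` such that `a * h` extends to a homomorphism on `P`. -/
def extensionIdeal {P : Type*} [AddCommGroup P] [Module Aᵐᵒᵖ P] (N : Submodule Aᵐᵒᵖ P)
    (h : N →ₗ[Aᵐᵒᵖ] A) : Submodule A A where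
  carrier := {a | ∃ g : P →ₗ[Aᵐᵒᵖ] A, ∀ n : N, g n = a * h n}
  add_mem' := by
    rintro a b ⟨g, hg⟩ ⟨g', hg'⟩
    exact ⟨g + g', fun n => by rw [LinearMap.add_apply, hg, hg', add_mul]⟩
  zero_mem' := ⟨0, by simp⟩
  smul_mem' := by
    rintro c a ⟨g, hg⟩
    exact ⟨(leftMul c).comp g, fun n => by
      rw [LinearMap.comp_apply, leftMul_apply, hg, smul_eq_mul, mul_assoc]⟩

/-- Over a semiprime Goldie ring, homomorphisms from a submodule of a free module to `A` extend up
to a left factor. This replaces the passage to the classical quotient ring `Q`, where all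
homomorphisms extend: if `N ⊕ X` is essential in `Aⁿ`, it contains elements `eᵢ dᵢ` with `dᵢ`
regular, and the left Ore condition brings the extension to a common left denominator. -/
theorem isEssentialSubmodule_extensionIdeal (hs : IsSemiprimeRing A) (hG : IsRightGoldie A)
    (hl : HasFiniteUniformDim A A) {n : ℕ} (N : Submodule Aᵐᵒᵖ (Fin n → A))
    (h : N →ₗ[Aᵐᵒᵖ] A) : IsEssentialSubmodule (extensionIdeal N h) := by
  obtain ⟨X, hNX, hess⟩ := exists_isEssentialSubmodule_sup N
  have h1 : ∀ i : Fin n, ∃ d, LinearMap.single Aᵐᵒᵖ (fun _ : Fin n => A) i d ∈ N ⊔ X ∧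
      IsEssentialSubmodule (LinearMap.range (leftMul d)) ∧
      IsEssentialSubmodule (LinearMap.range (LinearMap.toSpanSingleton A A d)) := fun i =>
    exists_regular_mem_essential hs hG hl (hess.comap (LinearMap.single Aᵐᵒᵖ (fun _ : Fin n => A) i))
  choose d hd hdr hdl using h1
  have h2 : ∀ i, ∃ m : N, ∃ y ∈ X, (m : Fin n → A) + y =
      LinearMap.single Aᵐᵒᵖ (fun _ : Fin n => A) i (d i) := fun i => by
    obtain ⟨m, hm, y, hy, hmy⟩ := Submodule.mem_sup.1 (hd i)
    exact ⟨⟨m, hm⟩, y, hy, hmy⟩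
  choose m y hy hmy using h2
  refine (IsEssentialSubmodule.iInf fun i => (hdl i).comap
    (LinearMap.toSpanSingleton A A (h (m i)))).mono fun a ha => ?_
  rw [Submodule.mem_iInf] at ha
  choose q hq using ha
  simp only [LinearMap.toSpanSingleton_apply, smul_eq_mul] at hq
  let g : (Fin n → A) →ₗ[Aᵐᵒᵖ] A := ∑ i, (leftMul (q i)).comp (LinearMap.proj i)
  have hg : ∀ v, g v = ∑ i, q i * v i := fun v => by simp [g]
  refine ⟨g, fun z => ?_⟩
  have hW : IsEssentialSubmodule (⨅ i, (LinearMap.range (leftMul (d i))).comap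
      (LinearMap.proj (R := Aᵐᵒᵖ) (φ := fun _ : Fin n => A) i)) :=
    IsEssentialSubmodule.iInf fun i => (hdr i).comap _
  rw [← sub_eq_zero]
  refine eq_zero_of_mul_essential_eq_zero hs hG.2
    (hW.comap (LinearMap.pi fun i => leftMul ((z : Fin n → A) i))) fun r hr => ?_
  rw [Submodule.mem_comap, Submodule.mem_iInf] at hr
  choose t ht using hr
  -- `z * r = ∑ eᵢ dᵢ tᵢ`, and as `z * r` lies in `N` its component in `X` vanishes
  have hzr : (MulOpposite.op r • z : N) = ∑ i, MulOpposite.op (t i) • m i := by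
    have hsum : ((MulOpposite.op r • z : N) : Fin n → A) =
        ∑ i, MulOpposite.op (t i) • ((m i : Fin n → A) + y i) := by
      ext i
      rw [Finset.sum_apply, Finset.sum_eq_single i]
      · rw [hmy]
        simpa using (ht i).symm
      · intro j _ hj
        rw [hmy]
        simp [Pi.single_eq_of_ne' hj]
      · simp
    have hX : (((MulOpposite.op r • z - ∑ i, MulOpposite.op (t i) • m i : N)) : Fin n → A) ∈ X := by
      have : (((MulOpposite.op r • z - ∑ i, MulOpposite.op (t i) • m i : N)) : Fin n → A) =
          ∑ i, MulOpposite.op (t i) • y i := by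
        rw [Submodule.coe_sub, hsum]
        simp [smul_add, Finset.sum_add_distrib]
      rw [this]
      exact Submodule.sum_mem _ fun i _ => X.smul_mem _ (hy i)
    rw [← sub_eq_zero]
    exact Subtype.ext (Submodule.disjoint_def.1 hNX _ (Subtype.prop _) hX)
  have h3 : g ((MulOpposite.op r • z : N) : Fin n → A) = a * h (MulOpposite.op r • z) := by
    have e1 : g ((MulOpposite.op r • z : N) : Fin n → A) = ∑ i, q i * (d i * t i) := by
      rw [hg]
      refine Finset.sum_congr rfl fun i _ => ?_
      have := ht i
      simp only [leftMul_apply] at this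
      rw [this]
      simp
    rw [e1, hzr, map_sum, Finset.mul_sum]
    refine Finset.sum_congr rfl fun i _ => ?_
    rw [map_smul, ← mul_assoc, hq, op_smul_eq_mul, mul_assoc]
  have h4 : MulOpposite.op r • (g z - a * h z) = 0 := by
    rw [smul_sub, ← map_smul, ← mul_smul_comm, ← map_smul, ← h3, Submodule.coe_smul, sub_self]
  exact h4

end Goldie

/-! ### Flat dimension and character modules -/

section Character

variable {A : Type w} [Ring A]

/-- The character module `Hom_ℤ(V, ℚ/ℤ)` of a right `A`-module `V`, with the left `A`-action
`(a χ)(v) = χ(v a)`. (Mathlib's `CharacterModule` has an action only over commutative rings.) -/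
def RightChar (V : Type*) [AddCommGroup V] : Type _ := V →+ AddCircle (1 : ℚ)

namespace RightChar

variable {V V' : Type*} [AddCommGroup V] [AddCommGroup V'] [Module Aᵐᵒᵖ V] [Module Aᵐᵒᵖ V']

instance : AddCommGroup (RightChar V) := inferInstanceAs (AddCommGroup (V →+ AddCircle (1 : ℚ)))

instance : FunLike (RightChar V) V (AddCircle (1 : ℚ)) :=
  inferInstanceAs (FunLike (V →+ AddCircle (1 : ℚ)) V (AddCircle (1 : ℚ)))

instance : AddMonoidHomClass (RightChar V) V (AddCircle (1 : ℚ)) :=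
  inferInstanceAs (AddMonoidHomClass (V →+ AddCircle (1 : ℚ)) V (AddCircle (1 : ℚ)))

theorem ext {χ χ' : RightChar V} (h : ∀ v, χ v = χ' v) : χ = χ' := DFunLike.ext _ _ h

@[simp] theorem add_apply (χ χ' : RightChar V) (v : V) : (χ + χ') v = χ v + χ' v := rfl

@[simp] theorem sub_apply (χ χ' : RightChar V) (v : V) : (χ - χ') v = χ v - χ' v := rfl

@[simp] theorem zero_apply (v : V) : (0 : RightChar V) v = 0 := rfl

@[simp] theorem sum_apply {ι : Type*} (s : Finset ι) (χ : ι → RightChar V) (v : V) :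
    (∑ i ∈ s, χ i) v = ∑ i ∈ s, χ i v :=
  AddMonoidHom.finsetSum_apply (N := AddCircle (1 : ℚ)) χ s v

instance : Module A (RightChar V) where
  smul a χ := AddMonoidHom.comp (show V →+ AddCircle (1 : ℚ) from χ)
    (DistribSMul.toAddMonoidHom V (MulOpposite.op a))
  one_smul χ := ext fun v => congrArg χ (one_smul Aᵐᵒᵖ v)
  mul_smul a b χ := ext fun v => congrArg χ (mul_smul (MulOpposite.op b) (MulOpposite.op a) v)
  smul_zero a := rfl
  smul_add a χ χ' := rfl
  add_smul a b χ := ext fun v => by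
    change χ (MulOpposite.op (a + b) • v) = χ (MulOpposite.op a • v) + χ (MulOpposite.op b • v)
    rw [MulOpposite.op_add, add_smul, map_add]
  zero_smul χ := ext fun v => by
    change χ (MulOpposite.op (0 : A) • v) = 0
    rw [MulOpposite.op_zero, zero_smul, map_zero]

@[simp] theorem smul_apply (a : A) (χ : RightChar V) (v : V) :
    (a • χ) v = χ (MulOpposite.op a • v) := rfl

/-- The map of character modules induced by a homomorphism of right modules. -/
def dual (f : V →ₗ[Aᵐᵒᵖ] V') : RightChar V' →ₗ[A] RightChar V where
  toFun χ := AddMonoidHom.comp (show V' →+ AddCircle (1 : ℚ) from χ) f.toAddMonoidHom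
  map_add' _ _ := rfl
  map_smul' a χ := ext fun v => congrArg χ (map_smul f (MulOpposite.op a) v).symm

@[simp] theorem dual_apply (f : V →ₗ[Aᵐᵒᵖ] V') (χ : RightChar V') (v : V) :
    dual f χ v = χ (f v) := rfl

theorem exists_extension {G G' : Type*} [AddCommGroup G] [AddCommGroup G'] (f : G →+ G')
    (hf : Function.Injective f) (χ : RightChar G) : ∃ χ' : RightChar G', ∀ g, χ' (f g) = χ g := by
  obtain ⟨χ', h⟩ := (Module.Baer.of_divisible (AddCircle (1 : ℚ))).extension_property_addMonoidHom
    f hf χ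
  exact ⟨χ', fun g => DFunLike.congr_fun h g⟩

theorem exists_apply_ne_zero {G : Type*} [AddCommGroup G] (S : AddSubgroup G) {g : G}
    (hg : g ∉ S) : ∃ χ : RightChar G, (∀ s ∈ S, χ s = 0) ∧ χ g ≠ 0 := by
  obtain ⟨c, hc⟩ := CharacterModule.exists_character_apply_ne_zero_of_ne_zero
    (a := (QuotientAddGroup.mk g : G ⧸ S)) (by rwa [Ne, QuotientAddGroup.eq_zero_iff])
  refine ⟨AddMonoidHom.comp (show (G ⧸ S) →+ AddCircle (1 : ℚ) from c) (QuotientAddGroup.mk' S),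
    fun s hs => ?_, hc⟩
  change c (QuotientAddGroup.mk s) = 0
  rw [(QuotientAddGroup.eq_zero_iff s).2 hs, map_zero]

end RightChar

section

variable {V : Type w} [AddCommGroup V] [Module Aᵐᵒᵖ V]

/-- The character of `V ⊗_A X` given by a homomorphism from `X` to the character module of `V`. -/
noncomputable def BalancedTensor.uncurry {X : Type w} [AddCommGroup X] [Module A X]
    (g : X →ₗ[A] RightChar V) : BalancedTensor A V X →+ AddCircle (1 : ℚ) :=
  QuotientAddGroup.lift _ (TensorProduct.liftAddHom
    (AddMonoidHom.flip (g.toAddMonoidHom : X →+ V →+ AddCircle (1 : ℚ)))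
    (fun n v y => by simp)) (by
    rw [balancedRelations, AddSubgroup.closure_le]
    rintro _ ⟨v, a, y, rfl⟩
    change TensorProduct.liftAddHom _ _ _ = 0
    rw [map_sub, sub_eq_zero]
    change g y (MulOpposite.op a • v) = g (a • y) v
    rw [map_smul g a y, RightChar.smul_apply])

theorem injective_rightChar_of_isFlat (h : IsFlatRightModule A V) :
    Module.Injective A (RightChar V) where
  out X Y _ _ _ _ f hf g := by
    obtain ⟨χ, hχ⟩ := RightChar.exists_extension _ (h X Y f hf) (BalancedTensor.uncurry g)
    let t : V →+ Y →+ BalancedTensor A V Y := AddMonoidHom.mk' (fun v => AddMonoidHom.mk'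
      (fun y => QuotientAddGroup.mk' (balancedRelations A V Y) (v ⊗ₜ[ℤ] y))
        (fun y y' => by rw [TensorProduct.tmul_add, map_add]))
        (fun v v' => by ext y; simp [TensorProduct.add_tmul])
    have ht : ∀ v (a : A) y, t (MulOpposite.op a • v) y = t v (a • y) := fun v a y => by
      rw [← sub_eq_zero]
      change QuotientAddGroup.mk' (balancedRelations A V Y) _ -
        QuotientAddGroup.mk' (balancedRelations A V Y) _ = 0
      rw [← map_sub]
      exact (QuotientAddGroup.eq_zero_iff _).2 (AddSubgroup.subset_closure ⟨v, a, y, rfl⟩)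
    let G : Y → RightChar V := fun y =>
      AddMonoidHom.comp (show BalancedTensor A V Y →+ AddCircle (1 : ℚ) from χ) (t.flip y)
    have hG : ∀ y v, G y v = χ (t v y) := fun _ _ => rfl
    refine ⟨{ toFun := G, map_add' := fun y y' => ?_, map_smul' := fun a y => ?_ }, fun x => ?_⟩
    · exact RightChar.ext fun v => by simp [hG]
    · exact RightChar.ext fun v => by simp [hG, ht]
    · refine RightChar.ext fun v => ?_
      exact hχ (QuotientAddGroup.mk' (balancedRelations A V X) (v ⊗ₜ[ℤ] x))

/-- A homomorphism to the character module of a projective module `V` amounts to a family of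
characters, and these extend. -/
theorem injective_rightChar_of_projective [Module.Projective Aᵐᵒᵖ V] :
    Module.Injective A (RightChar V) where
  out X Y _ _ _ _ f hf g := by
    obtain ⟨s, hs⟩ := Module.projective_def.1 ‹Module.Projective Aᵐᵒᵖ V›
    have h1 : ∀ q : V, ∃ χ : RightChar Y, ∀ x, χ (f x) = g x q := fun q =>
      RightChar.exists_extension f.toAddMonoidHom hf
        ((AddMonoidHom.flip (g.toAddMonoidHom : X →+ V →+ AddCircle (1 : ℚ))) q)
    choose χ hχ using h1
    let G : Y → RightChar V := fun y => AddMonoidHom.mk'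
      (fun v => (s v).sum fun q a => χ q (a.unop • y)) fun v v' => by
        rw [map_add, Finsupp.sum_add_index' (by simp) (by simp [add_smul])]
    have hG : ∀ y v, G y v = (s v).sum fun q a => χ q (a.unop • y) := fun _ _ => rfl
    refine ⟨{ toFun := G, map_add' := fun y y' => ?_, map_smul' := fun a y => ?_ }, fun x => ?_⟩
    · exact RightChar.ext fun v => by simp [hG, Finsupp.sum_add]
    · refine RightChar.ext fun v => ?_
      rw [RingHom.id_apply, RightChar.smul_apply, hG, hG, map_smul,
        Finsupp.sum_smul_index' (by simp)]
      simp [mul_smul]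
    · refine RightChar.ext fun v => ?_
      change G (f x) v = _
      rw [hG]
      have h2 : g x v = (s v).sum fun q a => g x (a • q) := by
        conv_lhs => rw [← hs v, Finsupp.linearCombination_apply]
        exact map_finsuppSum (g x) _ _
      rw [h2]
      refine Finsupp.sum_congr fun q _ => ?_
      rw [← map_smul f, hχ, map_smul, RightChar.smul_apply, MulOpposite.op_unop]

open CategoryTheory

/-- The character module of `V` has injective dimension at most `n`; equivalently, `V` has flat
dimension at most `n`. -/
def CharDimLE (A : Type w) [Ring A] (n : ℕ) (V : Type w) [AddCommGroup V] [Module Aᵐᵒᵖ V] : Prop :=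
  HasInjectiveDimensionLE (ModuleCat.of A (RightChar V)) n

theorem shortExact_rightChar {F : Type w} [AddCommGroup F] [Module Aᵐᵒᵖ F] (p : F →ₗ[Aᵐᵒᵖ] V)
    (hp : Function.Surjective p) :
    (ShortComplex.mk (ModuleCat.ofHom (RightChar.dual p))
      (ModuleCat.ofHom (RightChar.dual (LinearMap.ker p).subtype)) (by
        ext χ
        refine RightChar.ext fun v => ?_
        change χ (p v) = 0
        rw [v.2, map_zero])).ShortExact := by
  have hex : ∀ χ : RightChar F, RightChar.dual (LinearMap.ker p).subtype χ = 0 →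
      ∃ χ' : RightChar V, RightChar.dual p χ' = χ := by
    intro χ hχ
    choose s hs using hp
    have hker : ∀ v, p v = 0 → χ v = 0 := fun v hv =>
      DFunLike.congr_fun hχ (⟨v, hv⟩ : LinearMap.ker p)
    have hsub : ∀ v v', p v = p v' → χ v = χ v' := fun v v' h => by
      rw [← sub_eq_zero, ← map_sub]
      exact hker _ (by rw [map_sub, h, sub_self])
    refine ⟨AddMonoidHom.mk' (fun v => χ (s v)) fun v v' => ?_, RightChar.ext fun v => ?_⟩
    · rw [← map_add]
      exact hsub _ _ (by simp [hs])
    · exact hsub _ _ (hs _)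
  refine ModuleCat.shortComplex_shortExact _ ?_ ?_ ?_
  · rintro χ
    refine ⟨fun h => hex χ h, ?_⟩
    rintro ⟨χ', rfl⟩
    refine RightChar.ext fun v => ?_
    change χ' (p v) = 0
    rw [v.2, map_zero]
  · intro χ χ' h
    refine RightChar.ext fun v => ?_
    obtain ⟨y, rfl⟩ := hp v
    exact DFunLike.congr_fun h y
  · intro χ
    obtain ⟨χ', h⟩ := RightChar.exists_extension (LinearMap.ker p).subtype.toAddMonoidHom
      Subtype.val_injective χ
    exact ⟨χ', RightChar.ext h⟩

theorem shortExact_ker {F : Type w} [AddCommGroup F] [Module Aᵐᵒᵖ F] (p : F →ₗ[Aᵐᵒᵖ] V)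
    (hp : Function.Surjective p) :
    (ShortComplex.mk (ModuleCat.ofHom (LinearMap.ker p).subtype) (ModuleCat.ofHom p) (by
      ext v
      exact v.2)).ShortExact :=
  ModuleCat.shortComplex_shortExact _ (LinearMap.exact_subtype_ker_map p) Subtype.val_injective hp

theorem charDimLE_zero_iff : CharDimLE A 0 V ↔ Module.Injective A (RightChar V) := by
  rw [Module.injective_iff_injective_object, injective_iff_hasInjectiveDimensionLT_one]
  rfl

theorem CharDimLE.succ_of_ker {F : Type w} [AddCommGroup F] [Module Aᵐᵒᵖ F] {n : ℕ}
    (p : F →ₗ[Aᵐᵒᵖ] V) (hp : Function.Surjective p) (hF : Module.Injective A (RightChar F))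
    (h : CharDimLE A n (LinearMap.ker p)) : CharDimLE A (n + 1) V := by
  rw [Module.injective_iff_injective_object] at hF
  exact ((shortExact_rightChar p hp).hasInjectiveDimensionLT_X₃_iff n hF).1 h

theorem CharDimLE.ker_of_succ {F : Type w} [AddCommGroup F] [Module Aᵐᵒᵖ F] {n : ℕ}
    (p : F →ₗ[Aᵐᵒᵖ] V) (hp : Function.Surjective p) (hF : Module.Injective A (RightChar F))
    (h : CharDimLE A (n + 1) V) : CharDimLE A n (LinearMap.ker p) := by
  rw [Module.injective_iff_injective_object] at hF
  exact ((shortExact_rightChar p hp).hasInjectiveDimensionLT_X₃_iff n hF).2 h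

end

theorem charDimLE_of_flatDimLE (n : ℕ) : ∀ (V : Type w) [AddCommGroup V] [Module Aᵐᵒᵖ V],
    FlatDimLE A n V → CharDimLE A n V := by
  induction n with
  | zero =>
    intro V _ _ h
    exact charDimLE_zero_iff.2 (injective_rightChar_of_isFlat h)
  | succ n ih =>
    rintro V _ _ ⟨F, _, _, p, hF, hp, hK⟩
    exact CharDimLE.succ_of_ker p hp (injective_rightChar_of_isFlat hF) (ih _ hK)

open CategoryTheory in
theorem charDimLE_of_hasProjectiveDimensionLE (n : ℕ) :
    ∀ (V : Type w) [AddCommGroup V] [Module Aᵐᵒᵖ V],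
    HasProjectiveDimensionLE (ModuleCat.of Aᵐᵒᵖ V) n → CharDimLE A n V := by
  induction n with
  | zero =>
    intro V _ _ h
    have h1 : Projective (ModuleCat.of Aᵐᵒᵖ V) :=
      projective_iff_hasProjectiveDimensionLT_one.2 h
    have : Module.Projective Aᵐᵒᵖ V := (IsProjective.iff_projective _).2 h1
    exact charDimLE_zero_iff.2 injective_rightChar_of_projective
  | succ n ih =>
    intro V _ _ h
    let p : (V →₀ Aᵐᵒᵖ) →ₗ[Aᵐᵒᵖ] V := Finsupp.linearCombination Aᵐᵒᵖ id
    have hp : Function.Surjective p := Finsupp.linearCombination_id_surjective _ _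
    have hS := shortExact_ker p hp
    have hproj : Projective (ModuleCat.of Aᵐᵒᵖ (V →₀ Aᵐᵒᵖ)) :=
      (IsProjective.iff_projective (V →₀ Aᵐᵒᵖ)).1 inferInstance
    exact CharDimLE.succ_of_ker p hp injective_rightChar_of_projective
      (ih _ ((hS.hasProjectiveDimensionLT_X₃_iff n hproj).1 h))

theorem projective_of_retraction_ker {S F K : Type*} [Ring S] [AddCommGroup F] [Module S F]
    [AddCommGroup K] [Module S K] [Module.Projective S F] (p : F →ₗ[S] K)
    (hp : Function.Surjective p) (r : F →ₗ[S] LinearMap.ker p)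
    (hr : ∀ y ∈ LinearMap.ker p, (r y : F) = y) : Module.Projective S K := by
  have hle : LinearMap.ker p ≤ LinearMap.ker (LinearMap.id - (LinearMap.ker p).subtype.comp r) :=
    fun y hy => by
      rw [LinearMap.mem_ker, LinearMap.sub_apply, sub_eq_zero]
      exact (hr y hy).symm
  let e := p.quotKerEquivOfSurjective hp
  refine Module.Projective.of_split (((LinearMap.ker p).liftQ _ hle).comp e.symm.toLinearMap) p ?_
  ext y
  obtain ⟨y, rfl⟩ := hp y
  have h9 : e.symm (p y) = Submodule.Quotient.mk y := by
    rw [LinearEquiv.symm_apply_eq]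
    rfl
  rw [LinearMap.comp_apply, LinearMap.comp_apply, LinearEquiv.coe_coe, h9]
  rw [Submodule.liftQ_apply, LinearMap.sub_apply, map_sub]
  change p y - p (r y : F) = p y
  rw [(r y).2, sub_zero]

/-- A finitely presented module with injective character module (that is, a finitely presented flat
module) is projective. With `K = Aⁿ / R` and generators `r_j` of `R`, a retraction of `Aⁿ` onto `R`
is a solution `t ∈ Rⁿ` of the system `∑ t_i r_ji = r_j`. If there were none, a character of `R^m`
would detect this, and as the characters of `R` extend to `Aⁿ` in a linear way, it would detect
that `t_i = e_i` is not a solution in `Aⁿ`. -/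
theorem projective_of_finitePresentation_of_injective {K : Type w} [AddCommGroup K]
    [Module Aᵐᵒᵖ K] [Module.FinitePresentation Aᵐᵒᵖ K] (hK : Module.Injective A (RightChar K)) :
    Module.Projective Aᵐᵒᵖ K := by
  obtain ⟨n, p, hp⟩ := Module.Finite.exists_fin' Aᵐᵒᵖ K
  obtain ⟨m, r, hr⟩ := Submodule.fg_iff_exists_fin_generating_family.1
    (Module.FinitePresentation.fg_ker p hp)
  have hrm : ∀ j, r j ∈ LinearMap.ker p := fun j => hr ▸ Submodule.subset_span ⟨j, rfl⟩
  have hdual : Function.Injective (RightChar.dual (A := A) p) := fun χ χ' h =>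
    RightChar.ext fun v => by
      obtain ⟨y, rfl⟩ := hp v
      exact DFunLike.congr_fun h y
  obtain ⟨ret, hret⟩ := hK.out (RightChar.dual (A := A) p) hdual LinearMap.id
  let φ : (Fin n → LinearMap.ker p) →+ (Fin m → LinearMap.ker p) :=
    AddMonoidHom.mk' (fun t j => ∑ i, r j i • t i) fun t t' => by
      ext j : 1
      simp [Finset.sum_add_distrib]
  have hφ : ∀ t j, φ t j = ∑ i, r j i • t i := fun _ _ => rfl
  have hmem : (fun j => (⟨r j, hrm j⟩ : LinearMap.ker p)) ∈ φ.range := by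
    by_contra hnot
    obtain ⟨χ, hχ0, hχ⟩ := RightChar.exists_apply_ne_zero _ hnot
    refine hχ ?_
    have h1 : ∀ j, ∃ ψ : RightChar (Fin n → Aᵐᵒᵖ), (∀ y : LinearMap.ker p,
        ψ y = χ (Pi.single j y)) ∧ ret ψ = 0 := by
      intro j
      obtain ⟨ψ, hψ⟩ := RightChar.exists_extension (LinearMap.ker p).subtype.toAddMonoidHom
        Subtype.val_injective (AddMonoidHom.comp
          (show (Fin m → LinearMap.ker p) →+ AddCircle (1 : ℚ) from χ)
          (AddMonoidHom.single (fun _ : Fin m => LinearMap.ker p) j))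
      refine ⟨ψ - RightChar.dual p (ret ψ), fun y => ?_, ?_⟩
      · rw [RightChar.sub_apply, RightChar.dual_apply, y.2, map_zero, sub_zero]
        exact hψ y
      · rw [map_sub, hret, LinearMap.id_apply, sub_self]
    choose ψ hψ hψ0 using h1
    have h2 : ∀ i, ∑ j, (r j i).unop • ψ j = 0 := by
      intro i
      obtain ⟨κ, hκ⟩ : ∃ κ, RightChar.dual (A := A) p κ = ∑ j, (r j i).unop • ψ j := by
        have := (shortExact_rightChar (A := A) p hp).exact
        rw [CategoryTheory.ShortComplex.moduleCat_exact_iff] at this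
        refine this _ (RightChar.ext fun y => ?_)
        change (∑ j, (r j i).unop • ψ j) (y : Fin n → Aᵐᵒᵖ) = 0
        rw [RightChar.sum_apply]
        have h3 : φ (Pi.single i y) = ∑ j, Pi.single j (r j i • y) := by
          ext j : 1
          rw [hφ, Finset.sum_eq_single i (by
            intro b _ hb; rw [Pi.single_eq_of_ne hb, smul_zero]) (by simp), Pi.single_eq_same,
            Finset.sum_apply, Finset.sum_eq_single j (by
            intro b _ hb; rw [Pi.single_eq_of_ne' hb]) (by simp), Pi.single_eq_same]
        have h4 := hχ0 _ ⟨Pi.single i y, rfl⟩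
        rw [h3, map_sum] at h4
        rw [← h4]
        exact Finset.sum_congr rfl fun j _ => hψ j (r j i • y)
      have h5 : κ = 0 := by
        have := hret κ
        rw [hκ, map_sum] at this
        simpa [hψ0] using this.symm
      rw [← hκ, h5, map_zero]
    have h6 : (fun j => (⟨r j, hrm j⟩ : LinearMap.ker p)) =
        ∑ j, Pi.single j (⟨r j, hrm j⟩ : LinearMap.ker p) :=
      (Finset.univ_sum_single _).symm
    rw [h6, map_sum]
    have h7 : ∀ j, χ (Pi.single j (⟨r j, hrm j⟩ : LinearMap.ker p)) =
        ∑ i, ((r j i).unop • ψ j) (Pi.single i 1) := by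
      intro j
      rw [← hψ]
      change ψ j (r j) = _
      conv_lhs => rw [← Finset.univ_sum_single (r j), map_sum]
      refine Finset.sum_congr rfl fun i _ => ?_
      rw [RightChar.smul_apply, MulOpposite.op_unop, ← Pi.single_smul, smul_eq_mul, mul_one]
    rw [Finset.sum_congr rfl fun j _ => h7 j, Finset.sum_comm]
    refine Finset.sum_eq_zero fun i _ => ?_
    rw [← RightChar.sum_apply, h2, RightChar.zero_apply]
  obtain ⟨t, ht⟩ := hmem
  let θ : (Fin n → Aᵐᵒᵖ) →ₗ[Aᵐᵒᵖ] LinearMap.ker p := Fintype.linearCombination Aᵐᵒᵖ t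
  have hθ : LinearMap.ker p ≤ LinearMap.ker (LinearMap.id - (LinearMap.ker p).subtype.comp θ) := by
    conv_lhs => rw [← hr]
    rw [Submodule.span_le]
    rintro _ ⟨j, rfl⟩
    have h8 := congrFun ht j
    rw [hφ] at h8
    rw [SetLike.mem_coe, LinearMap.mem_ker, LinearMap.sub_apply, sub_eq_zero]
    change r j = ((θ (r j) : LinearMap.ker p) : Fin n → Aᵐᵒᵖ)
    rw [Fintype.linearCombination_apply, h8]
  refine projective_of_retraction_ker p hp θ fun y hy => ?_
  have := hθ hy
  rw [LinearMap.mem_ker, LinearMap.sub_apply, sub_eq_zero] at this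
  exact this.symm

end Character

section Coherent

variable {A : Type w} [Ring A]

theorem IsRightCoherent.finitePresentation_of_fg (h : IsRightCoherent A) {n : ℕ}
    (N : Submodule Aᵐᵒᵖ (Fin n → A)) (hN : N.FG) : Module.FinitePresentation Aᵐᵒᵖ N := by
  induction n with
  | zero =>
    have : Subsingleton N := inferInstance
    have : Module.FinitePresentation Aᵐᵒᵖ PUnit.{1} :=
      Module.finitePresentation_of_projective Aᵐᵒᵖ PUnit
    exact Module.FinitePresentation.of_equiv (default : PUnit.{1} ≃ₗ[Aᵐᵒᵖ] N)
  | succ n ih =>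
    have hNfin : Module.Finite Aᵐᵒᵖ N := Module.Finite.of_fg hN
    let f : N →ₗ[Aᵐᵒᵖ] A := (LinearMap.proj (0 : Fin (n + 1))).comp N.subtype
    have hI : (LinearMap.range f).FG := Module.Finite.iff_fg.1 inferInstance
    have := h _ hI
    have hker : (LinearMap.ker f.rangeRestrict).FG :=
      Module.FinitePresentation.fg_ker _ f.surjective_rangeRestrict
    let g : LinearMap.ker f.rangeRestrict →ₗ[Aᵐᵒᵖ] (Fin n → A) :=
      (LinearMap.funLeft Aᵐᵒᵖ A Fin.succ).comp (N.subtype.comp (Submodule.subtype _))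
    have hg : Function.Injective g := by
      rw [injective_iff_map_eq_zero]
      intro v hv
      refine Subtype.ext (Subtype.ext ?_)
      ext i
      refine Fin.cases ?_ (fun i => ?_) i
      · exact congrArg Subtype.val v.2
      · exact congrFun hv i
    have hkfin : Module.Finite Aᵐᵒᵖ (LinearMap.ker f.rangeRestrict) := Module.Finite.of_fg hker
    have := ih (LinearMap.range g) (Module.Finite.iff_fg.1 inferInstance)
    have := Module.FinitePresentation.of_equiv (R := Aᵐᵒᵖ) (M := LinearMap.range g)
      (N := LinearMap.ker f.rangeRestrict) (LinearEquiv.ofInjective g hg).symm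
    exact Module.finitePresentation_of_ker _ f.surjective_rangeRestrict

end Coherent

/-! ### Subcomodules and slices -/

section Slice

variable {k : Type*} {H : Type*} [Field k] [Ring H] [HopfAlgebra k H]
  {M : Type*} [AddCommGroup M] [Module k M] {M' : Type*} [AddCommGroup M'] [Module k M']

/-- The map `M ⊗ ξ : M ⊗ H → M` given by a functional `ξ` on `H`. -/
noncomputable def slice (M : Type*) [AddCommGroup M] [Module k M] (ξ : H →ₗ[k] k) :
    M ⊗[k] H →ₗ[k] M :=
  (TensorProduct.rid k M).toLinearMap ∘ₗ ξ.lTensor M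

@[simp] theorem slice_tmul (ξ : H →ₗ[k] k) (m : M) (h : H) : slice M ξ (m ⊗ₜ h) = ξ h • m := by
  simp [slice]

theorem slice_rTensor (f : M →ₗ[k] M') (ξ : H →ₗ[k] k) (t : M ⊗[k] H) :
    slice M' ξ (f.rTensor H t) = f (slice M ξ t) := by
  induction t with
  | zero => simp
  | add t t' h h' => simp [h, h']
  | tmul m h => simp

/-- An element of `M ⊗ H` is recovered from its slices along a basis of `H`, of which almost all
vanish. -/
theorem exists_sum_slice {ι : Type*} (b : Module.Basis ι k H) (t : M ⊗[k] H) :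
    (∃ s : Finset ι, ∀ i ∉ s, slice M (b.coord i) t = 0) ∧
    ∀ s : Finset ι, (∀ i ∉ s, slice M (b.coord i) t = 0) →
      t = ∑ i ∈ s, slice M (b.coord i) t ⊗ₜ[k] b i := by
  have h1 : ∃ s : Finset ι, (∀ i ∉ s, slice M (b.coord i) t = 0) ∧
      t = ∑ i ∈ s, slice M (b.coord i) t ⊗ₜ[k] b i := by
    classical
    induction t with
    | zero => exact ⟨∅, by simp⟩
    | tmul m h =>
      refine ⟨(b.repr h).support, fun i hi => ?_, ?_⟩
      · rw [slice_tmul, Module.Basis.coord_apply, Finsupp.notMem_support_iff.1 hi, zero_smul]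
      · conv_lhs => rw [← b.linearCombination_repr h, Finsupp.linearCombination_apply, Finsupp.sum,
          TensorProduct.tmul_sum]
        refine Finset.sum_congr rfl fun i _ => ?_
        rw [slice_tmul, Module.Basis.coord_apply, TensorProduct.tmul_smul,
          TensorProduct.smul_tmul']
    | add t t' h h' =>
      obtain ⟨s, hs, ht⟩ := h
      obtain ⟨s', hs', ht'⟩ := h'
      refine ⟨s ∪ s', fun i hi => ?_, ?_⟩
      · rw [Finset.mem_union, not_or] at hi
        rw [map_add, hs i hi.1, hs' i hi.2, add_zero]
      · simp only [map_add, TensorProduct.add_tmul, Finset.sum_add_distrib]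
        rw [← Finset.sum_subset (Finset.subset_union_left (s₂ := s')) (fun i _ hi => by
          rw [hs i hi, TensorProduct.zero_tmul]), ← ht,
          ← Finset.sum_subset (Finset.subset_union_right (s₁ := s)) (fun i _ hi => by
          rw [hs' i hi, TensorProduct.zero_tmul]), ← ht']
  obtain ⟨s, hs, ht⟩ := h1
  refine ⟨⟨s, hs⟩, fun s' hs' => ?_⟩
  classical
  conv_lhs => rw [ht]
  rw [Finset.sum_subset (Finset.subset_union_left (s₂ := s')) (fun i _ hi => by
      rw [hs i hi, TensorProduct.zero_tmul])]
  exact (Finset.sum_subset (Finset.subset_union_right (s₁ := s)) (fun i _ hi => by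
      rw [hs' i hi, TensorProduct.zero_tmul])).symm

theorem slice_ext {t t' : M ⊗[k] H} (h : ∀ ξ : H →ₗ[k] k, slice M ξ t = slice M ξ t') :
    t = t' := by
  rw [← sub_eq_zero]
  have := (exists_sum_slice (Module.Basis.ofVectorSpace k H) (t - t')).2 ∅
    (fun i _ => by rw [map_sub, h, sub_self])
  simpa using this

theorem mem_range_rTensor_iff (U : Submodule k M) (t : M ⊗[k] H) :
    t ∈ LinearMap.range (U.subtype.rTensor H) ↔ ∀ ξ : H →ₗ[k] k, slice M ξ t ∈ U := by
  constructor
  · rintro ⟨t, rfl⟩ ξ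
    rw [slice_rTensor]
    exact Subtype.prop _
  · intro h
    obtain ⟨⟨s, hs⟩, h2⟩ := exists_sum_slice (Module.Basis.ofVectorSpace k H) t
    rw [h2 s hs]
    exact Submodule.sum_mem _ fun i _ =>
      ⟨(⟨_, h ((Module.Basis.ofVectorSpace k H).coord i)⟩ : U) ⊗ₜ Module.Basis.ofVectorSpace k H i,
        by simp⟩

theorem RightComodule.isSubcomodule_iff (δ : RightComodule k H M) (U : Submodule k M) :
    δ.IsSubcomodule U ↔ ∀ m ∈ U, ∀ ξ : H →ₗ[k] k, slice M ξ (δ.coact m) ∈ U :=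
  forall₂_congr fun _ _ => mem_range_rTensor_iff _ _

/-- The right coregular action `h ↦ h₍₁₎ ξ(h₍₂₎)` of a functional `ξ` on `H`. -/
noncomputable def coregular (ξ : H →ₗ[k] k) : H →ₗ[k] H := slice H ξ ∘ₗ Coalgebra.comul

theorem RightComodule.coact_slice (δ : RightComodule k H M) (ξ : H →ₗ[k] k) (m : M) :
    δ.coact (slice M ξ (δ.coact m)) = (coregular ξ).lTensor M (δ.coact m) := by
  have h1 : ∀ t : M ⊗[k] H, δ.coact (slice M ξ t) = (slice H ξ).lTensor M
      (TensorProduct.assoc k M H H (δ.coact.rTensor H t)) := by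
    intro t
    induction t with
    | zero => simp
    | add t t' h h' => simp [h, h']
    | tmul m h =>
      rw [slice_tmul, map_smul, LinearMap.rTensor_tmul]
      induction δ.coact m with
      | zero => simp
      | add t t' h h' => simp [h, h', TensorProduct.add_tmul]
      | tmul m' h' => simp
  rw [h1, δ.coassoc, ← LinearMap.comp_apply, ← LinearMap.lTensor_comp]
  rfl

theorem RightComodule.slice_counit (δ : RightComodule k H M) (m : M) :
    slice M Coalgebra.counit (δ.coact m) = m := δ.counit m

theorem RightComodule.slice_slice (δ : RightComodule k H M) (ξ ζ : H →ₗ[k] k) (m : M) :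
    slice M ζ (δ.coact (slice M ξ (δ.coact m))) = slice M (ζ ∘ₗ coregular ξ) (δ.coact m) := by
  rw [δ.coact_slice]
  induction δ.coact m with
  | zero => simp
  | add t t' h h' => simp [h, h']
  | tmul m' h' => simp

/-- Each element of a comodule lies in a finite-dimensional subcomodule. -/
theorem RightComodule.exists_finite_subcomodule (δ : RightComodule k H M) (m : M) :
    ∃ C : Submodule k M, m ∈ C ∧ Module.Finite k C ∧ δ.IsSubcomodule C ∧
      ∀ U : Submodule k M, δ.IsSubcomodule U → m ∈ U → C ≤ U := by
  let C : Submodule k M := Submodule.span k (Set.range fun ξ : H →ₗ[k] k => slice M ξ (δ.coact m))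
  refine ⟨C, ?_, ?_, ?_, fun U hU hm => ?_⟩
  · exact Submodule.subset_span ⟨Coalgebra.counit, δ.slice_counit m⟩
  · let b := Module.Basis.ofVectorSpace k H
    obtain ⟨⟨s, hs⟩, h2⟩ := exists_sum_slice b (δ.coact m)
    have h3 := h2 s hs
    have hle : C ≤ Submodule.span k ((fun i => slice M (b.coord i) (δ.coact m)) '' s) := by
      refine Submodule.span_le.2 ?_
      rintro _ ⟨ξ, rfl⟩
      rw [SetLike.mem_coe]
      beta_reduce
      have h4 : slice M ξ (δ.coact m) = ∑ i ∈ s, ξ (b i) • slice M (b.coord i) (δ.coact m) := by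
        conv_lhs => rw [h3, map_sum]
        exact Finset.sum_congr rfl fun i _ => slice_tmul _ _ _
      rw [h4]
      refine Submodule.sum_mem _ fun i hi => ?_
      exact Submodule.smul_mem _ _ (Submodule.subset_span ⟨i, hi, rfl⟩)
    have : Module.Finite k (Submodule.span k ((fun i => slice M (b.coord i) (δ.coact m)) '' s)) :=
      Module.Finite.span_of_finite k (s.finite_toSet.image _)
    exact Submodule.finiteDimensional_of_le hle
  · rw [δ.isSubcomodule_iff]
    intro c hc ξ
    induction hc using Submodule.span_induction with
    | zero => simp
    | add c c' _ _ h h' => simpa using add_mem h h'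
    | smul r c _ h => simpa using Submodule.smul_mem _ r h
    | mem c hc =>
      obtain ⟨ζ, rfl⟩ := hc
      rw [δ.slice_slice]
      exact Submodule.subset_span ⟨_, rfl⟩
  · rw [δ.isSubcomodule_iff] at hU
    refine Submodule.span_le.2 ?_
    rintro _ ⟨ξ, rfl⟩
    exact hU m hm ξ

/-- The comodule structure on a module which embeds as a subcomodule. -/
theorem RightComodule.exists_of_injective (δ : RightComodule k H M) (i : M' →ₗ[k] M)
    (hi : Function.Injective i) (h : ∀ m, ∀ ξ : H →ₗ[k] k, ∃ m', i m' = slice M ξ (δ.coact (i m))) :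
    ∃ δ' : RightComodule k H M', ∀ m, i.rTensor H (δ'.coact m) = δ.coact (i m) := by
  have hinj : Function.Injective (i.rTensor H) := Module.Flat.rTensor_preserves_injective_linearMap i hi
  have hr : ∀ m, δ.coact (i m) ∈ LinearMap.range (i.rTensor H) := by
    intro m
    obtain ⟨⟨s, hs⟩, h2⟩ := exists_sum_slice (Module.Basis.ofVectorSpace k H) (δ.coact (i m))
    rw [h2 s hs]
    refine Submodule.sum_mem _ fun j _ => ?_
    obtain ⟨m', hm'⟩ := h m ((Module.Basis.ofVectorSpace k H).coord j)
    exact ⟨m' ⊗ₜ _, by rw [LinearMap.rTensor_tmul, hm']⟩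
  let e := LinearEquiv.ofInjective (i.rTensor H) hinj
  let c : M' →ₗ[k] M' ⊗[k] H :=
    e.symm.toLinearMap ∘ₗ (δ.coact ∘ₗ i).codRestrict (LinearMap.range (i.rTensor H)) hr
  have hc : ∀ m, i.rTensor H (c m) = δ.coact (i m) := fun m =>
    congrArg Subtype.val (e.apply_symm_apply ⟨_, hr m⟩)
  refine ⟨⟨c, fun m => ?_, fun m => ?_⟩, hc⟩
  · have hinj2 : Function.Injective (i.rTensor (H ⊗[k] H)) :=
      Module.Flat.rTensor_preserves_injective_linearMap i hi
    apply hinj2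
    have h1 : ∀ t : M' ⊗[k] H, i.rTensor (H ⊗[k] H) (TensorProduct.assoc k M' H H (c.rTensor H t)) =
        TensorProduct.assoc k M H H (δ.coact.rTensor H (i.rTensor H t)) := by
      intro t
      induction t with
      | zero => simp
      | add t t' h h' => simp only [map_add, h, h']
      | tmul m h =>
        rw [LinearMap.rTensor_tmul, LinearMap.rTensor_tmul, LinearMap.rTensor_tmul, ← hc]
        induction c m with
        | zero => simp
        | add t t' h h' => simp only [map_add, h, h', TensorProduct.add_tmul]
        | tmul m' h' => simp
    rw [h1, hc, δ.coassoc, ← hc]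
    induction c m with
    | zero => simp
    | add t t' h h' => simp only [map_add, h, h']
    | tmul m' h' => simp
  · apply hi
    change i (slice M' Coalgebra.counit (c m)) = i m
    rw [← slice_rTensor, hc]
    exact δ.counit _

/-- The comodule structure on a quotient by a subcomodule. -/
theorem RightComodule.exists_of_surjective (δ : RightComodule k H M) (p : M →ₗ[k] M')
    (hp : Function.Surjective p)
    (h : ∀ m, p m = 0 → ∀ ξ : H →ₗ[k] k, p (slice M ξ (δ.coact m)) = 0) :
    ∃ δ' : RightComodule k H M', ∀ m, p.rTensor H (δ.coact m) = δ'.coact (p m) := by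
  have hle : LinearMap.ker p ≤ LinearMap.ker (p.rTensor H ∘ₗ δ.coact) := by
    intro m hm
    refine slice_ext fun ξ => ?_
    rw [LinearMap.comp_apply, slice_rTensor, h m hm, map_zero]
  let c : M' →ₗ[k] M' ⊗[k] H := (LinearMap.ker p).liftQ _ hle ∘ₗ
    (p.quotKerEquivOfSurjective hp).symm.toLinearMap
  have hc : ∀ m, p.rTensor H (δ.coact m) = c (p m) := fun m => by
    have h9 : (p.quotKerEquivOfSurjective hp).symm (p m) = Submodule.Quotient.mk m := by
      rw [LinearEquiv.symm_apply_eq]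
      rfl
    rw [LinearMap.comp_apply, LinearEquiv.coe_coe, h9, Submodule.liftQ_apply]
    rfl
  refine ⟨⟨c, fun m => ?_, fun m => ?_⟩, hc⟩
  · obtain ⟨m, rfl⟩ := hp m
    rw [← hc]
    have h1 : ∀ t : M ⊗[k] H, TensorProduct.assoc k M' H H (c.rTensor H (p.rTensor H t)) =
        p.rTensor (H ⊗[k] H) (TensorProduct.assoc k M H H (δ.coact.rTensor H t)) := by
      intro t
      induction t with
      | zero => simp
      | add t t' h h' => simp only [map_add, h, h']
      | tmul m h =>
        rw [LinearMap.rTensor_tmul, LinearMap.rTensor_tmul, LinearMap.rTensor_tmul, ← hc]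
        induction δ.coact m with
        | zero => simp
        | add t t' h h' => simp only [map_add, h, h', TensorProduct.add_tmul]
        | tmul m' h' => simp
    rw [h1, δ.coassoc]
    induction δ.coact m with
    | zero => simp
    | add t t' h h' => simp only [map_add, h, h']
    | tmul m' h' => simp
  · obtain ⟨m, rfl⟩ := hp m
    change slice M' Coalgebra.counit (c (p m)) = p m
    rw [← hc, slice_rTensor, δ.slice_counit]

end Slice

/-! ### Hopf submodules and quotients -/

section HopfModule

variable {k : Type*} {H : Type*} [Field k] [Ring H] [HopfAlgebra k H]
  {A : Type*} [Ring A] [Algebra k A] {ρ : RightComoduleAlgebra k H A}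
  {P : Type*} [AddCommGroup P] [Module k P] [Module Aᵐᵒᵖ P] [IsScalarTower k Aᵐᵒᵖ P]
  {Q : Type*} [AddCommGroup Q] [Module k Q] [Module Aᵐᵒᵖ Q] [IsScalarTower k Aᵐᵒᵖ Q]

@[simp] theorem tensorRightAction_tmul (p : P) (h g : H) (a : A) :
    tensorRightAction k H A P (p ⊗ₜ h) (a ⊗ₜ g) = (MulOpposite.op a • p) ⊗ₜ (h * g) := rfl

theorem rTensor_tensorRightAction (f : P →ₗ[Aᵐᵒᵖ] Q) (t : P ⊗[k] H) (b : A ⊗[k] H) :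
    (f.restrictScalars k).rTensor H (tensorRightAction k H A P t b) =
      tensorRightAction k H A Q ((f.restrictScalars k).rTensor H t) b := by
  induction t with
  | zero => simp
  | add t t' h h' => simp only [map_add, LinearMap.add_apply, h, h']
  | tmul p h =>
    induction b with
    | zero => simp
    | add t t' h h' => simp only [map_add, h, h']
    | tmul a g => simp

theorem slice_tensorRightAction (ξ : H →ₗ[k] k) (t : P ⊗[k] H) (a : A) (g : H) :
    slice P ξ (tensorRightAction k H A P t (a ⊗ₜ g)) =
      MulOpposite.op a • slice P (ξ ∘ₗ LinearMap.mulRight k g) t := by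
  induction t with
  | zero => simp
  | add t t' h h' => simp only [map_add, LinearMap.add_apply, h, h', smul_add]
  | tmul p h =>
    have : SMulCommClass k Aᵐᵒᵖ P := IsScalarTower.to_smulCommClass
    rw [tensorRightAction_tmul, slice_tmul, slice_tmul, smul_comm]
    rfl

/-- A homomorphism of right `A`-modules which commutes with the coactions. -/
def IsHopfMap (σ : RightHopfModule ρ P) (τ : RightHopfModule ρ Q) (f : P →ₗ[Aᵐᵒᵖ] Q) : Prop :=
  ∀ p, (f.restrictScalars k).rTensor H (σ.coact p) = τ.coact (f p)

theorem IsHopfMap.slice_eq {σ : RightHopfModule ρ P} {τ : RightHopfModule ρ Q}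
    {f : P →ₗ[Aᵐᵒᵖ] Q} (hf : IsHopfMap σ τ f) (ξ : H →ₗ[k] k) (p : P) :
    f (slice P ξ (σ.coact p)) = slice Q ξ (τ.coact (f p)) := by
  rw [← hf, slice_rTensor]
  rfl

/-- The submodule `N` is stable under the coaction. -/
def RightHopfModule.IsHopfSub (σ : RightHopfModule ρ P) (N : Submodule Aᵐᵒᵖ P) : Prop :=
  ∀ n ∈ N, ∀ ξ : H →ₗ[k] k, slice P ξ (σ.coact n) ∈ N

theorem RightHopfModule.exists_of_injective (σ : RightHopfModule ρ P) (i : Q →ₗ[Aᵐᵒᵖ] P)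
    (hi : Function.Injective i)
    (h : ∀ m, ∀ ξ : H →ₗ[k] k, ∃ m', i m' = slice P ξ (σ.coact (i m))) :
    ∃ τ : RightHopfModule ρ Q, IsHopfMap τ σ i := by
  obtain ⟨δ, hδ⟩ := σ.toRightComodule.exists_of_injective (i.restrictScalars k) hi h
  refine ⟨⟨δ, fun m a => ?_⟩, hδ⟩
  apply Module.Flat.rTensor_preserves_injective_linearMap (M := H) (i.restrictScalars k) hi
  rw [rTensor_tensorRightAction, hδ, hδ]
  simp only [LinearMap.coe_restrictScalars, map_smul]
  exact σ.coact_smul _ _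

theorem RightHopfModule.exists_of_surjective (σ : RightHopfModule ρ P) (p : P →ₗ[Aᵐᵒᵖ] Q)
    (hp : Function.Surjective p) (h : σ.IsHopfSub (LinearMap.ker p)) :
    ∃ τ : RightHopfModule ρ Q, IsHopfMap σ τ p := by
  obtain ⟨δ, hδ⟩ := σ.toRightComodule.exists_of_surjective (p.restrictScalars k) hp h
  refine ⟨⟨δ, fun m a => ?_⟩, hδ⟩
  obtain ⟨m, rfl⟩ := hp m
  rw [← map_smul]
  refine (hδ _).symm.trans ?_
  rw [σ.coact_smul, rTensor_tensorRightAction, hδ]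
  rfl

theorem RightHopfModule.IsHopfSub.exists_hopfModule {σ : RightHopfModule ρ P}
    {N : Submodule Aᵐᵒᵖ P} (hN : σ.IsHopfSub N) :
    ∃ τ : RightHopfModule ρ N, IsHopfMap τ σ N.subtype :=
  σ.exists_of_injective N.subtype N.subtype_injective fun m ξ => ⟨⟨_, hN m m.2 ξ⟩, rfl⟩

theorem RightHopfModule.IsHopfSub.exists_quotient {σ : RightHopfModule ρ P}
    {N : Submodule Aᵐᵒᵖ P} (hN : σ.IsHopfSub N) :
    ∃ τ : RightHopfModule ρ (P ⧸ N), IsHopfMap σ τ N.mkQ :=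
  σ.exists_of_surjective N.mkQ N.mkQ_surjective (by rwa [Submodule.ker_mkQ])

theorem IsHopfMap.isHopfSub_ker {σ : RightHopfModule ρ P} {τ : RightHopfModule ρ Q}
    {f : P →ₗ[Aᵐᵒᵖ] Q} (hf : IsHopfMap σ τ f) : σ.IsHopfSub (LinearMap.ker f) := by
  intro n hn ξ
  rw [LinearMap.mem_ker] at hn ⊢
  rw [hf.slice_eq, hn, map_zero, map_zero]

theorem IsHopfMap.isHopfSub_comap {σ : RightHopfModule ρ P} {τ : RightHopfModule ρ Q}
    {f : P →ₗ[Aᵐᵒᵖ] Q} (hf : IsHopfMap σ τ f) {N : Submodule Aᵐᵒᵖ Q} (hN : τ.IsHopfSub N) :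
    σ.IsHopfSub (N.comap f) := by
  intro n hn ξ
  rw [Submodule.mem_comap, hf.slice_eq]
  exact hN _ hn ξ

theorem RightHopfModule.isHopfSub_bot (σ : RightHopfModule ρ P) : σ.IsHopfSub ⊥ := by
  intro n hn ξ
  rw [Submodule.mem_bot] at hn ⊢
  rw [hn, map_zero, map_zero]

theorem RightHopfModule.IsHopfSub.sup {σ : RightHopfModule ρ P} {N N' : Submodule Aᵐᵒᵖ P}
    (h : σ.IsHopfSub N) (h' : σ.IsHopfSub N') : σ.IsHopfSub (N ⊔ N') := by
  intro n hn ξ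
  obtain ⟨a, ha, b, hb, rfl⟩ := Submodule.mem_sup.1 hn
  rw [map_add, map_add]
  exact Submodule.add_mem_sup (h a ha ξ) (h' b hb ξ)

theorem RightHopfModule.isHopfSub_span (σ : RightHopfModule ρ P) {C : Submodule k P}
    (hC : σ.toRightComodule.IsSubcomodule C) :
    σ.IsHopfSub (Submodule.span Aᵐᵒᵖ (C : Set P)) := by
  rw [RightComodule.isSubcomodule_iff] at hC
  intro n hn
  induction hn using Submodule.span_induction with
  | mem c hc => exact fun ξ => Submodule.subset_span (hC c hc ξ)
  | zero => simp
  | add n n' _ _ h h' => exact fun ξ => by simpa using add_mem (h ξ) (h' ξ)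
  | smul a n _ h =>
    intro ξ
    obtain ⟨a, rfl⟩ := MulOpposite.op_surjective a
    rw [σ.coact_smul]
    induction ρ.coact a with
    | zero => simp
    | add t t' h h' => simpa using add_mem h h'
    | tmul a g =>
      rw [slice_tensorRightAction]
      exact Submodule.smul_mem _ _ (h _)

/-- Hopf modules are locally finitely generated. -/
theorem RightHopfModule.exists_fg_hopfSub (σ : RightHopfModule ρ P) (p : P) :
    ∃ N : Submodule Aᵐᵒᵖ P, p ∈ N ∧ N.FG ∧ σ.IsHopfSub N ∧
      ∀ K : Submodule Aᵐᵒᵖ P, σ.IsHopfSub K → p ∈ K → N ≤ K := by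
  obtain ⟨C, hpC, hfin, hC, hmin⟩ := σ.toRightComodule.exists_finite_subcomodule p
  refine ⟨Submodule.span Aᵐᵒᵖ C, Submodule.subset_span hpC, ?_, σ.isHopfSub_span hC,
    fun K hK hp => Submodule.span_le.2 ?_⟩
  · obtain ⟨s, hs⟩ := Module.Finite.iff_fg.1 hfin
    refine ⟨s, le_antisymm (Submodule.span_mono ?_) (Submodule.span_le.2 ?_)⟩
    · rw [← hs]
      exact Submodule.subset_span
    · rw [← hs]
      exact Submodule.span_subset_span k Aᵐᵒᵖ _
  · exact hmin (K.restrictScalars k) ((RightComodule.isSubcomodule_iff _ _).2 hK) hp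

/-- A finitely generated Hopf module is generated by a finite-dimensional subcomodule. -/
theorem RightHopfModule.exists_finite_generating (σ : RightHopfModule ρ P)
    [Module.Finite Aᵐᵒᵖ P] : ∃ C : Submodule k P, Module.Finite k C ∧
      σ.toRightComodule.IsSubcomodule C ∧ Submodule.span Aᵐᵒᵖ (C : Set P) = ⊤ := by
  classical
  obtain ⟨s, hs⟩ := Module.Finite.fg_top (R := Aᵐᵒᵖ) (M := P)
  choose C hpC hfin hC _ using σ.toRightComodule.exists_finite_subcomodule
  refine ⟨⨆ p : s, C p, inferInstance, ?_, ?_⟩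
  · rw [RightComodule.isSubcomodule_iff]
    intro m hm ξ
    refine Submodule.iSup_induction (fun p : s => C p) (motive := fun m =>
      slice P ξ (σ.coact m) ∈ ⨆ p : s, C p) hm (fun p m hm => ?_) (by simp)
      fun a b ha hb => by simpa using add_mem ha hb
    exact Submodule.mem_iSup_of_mem p ((RightComodule.isSubcomodule_iff _ _).1 (hC p) m hm ξ)
  · rw [eq_top_iff, ← hs]
    refine Submodule.span_mono fun p hp => ?_
    exact Submodule.mem_iSup_of_mem (p := fun p : s => C p) ⟨p, hp⟩ (hpC p)

end HopfModule

/-! ### Extension of homomorphisms to `A` -/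

section Twist

variable {k : Type*} {H : Type*} [Field k] [Ring H] [HopfAlgebra k H]
  {A : Type*} [Ring A] [Algebra k A]
  {M : Type*} [AddCommGroup M] [Module k M] {M' : Type*} [AddCommGroup M'] [Module k M']

/-- The map `M ⊗ H → A ⊗ H`, `m ⊗ h ↦ φ(m) (1 ⊗ s(h))`. -/
noncomputable def twist (φ : M →ₗ[k] A ⊗[k] H) (s : H →ₗ[k] H) : M ⊗[k] H →ₗ[k] A ⊗[k] H :=
  LinearMap.mul' k (A ⊗[k] H) ∘ₗ TensorProduct.map φ (TensorProduct.mk k A H 1 ∘ₗ s)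

@[simp] theorem twist_tmul (φ : M →ₗ[k] A ⊗[k] H) (s : H →ₗ[k] H) (m : M) (h : H) :
    twist φ s (m ⊗ₜ h) = φ m * (1 ⊗ₜ s h) := by
  simp [twist]

theorem twist_rTensor (φ : M →ₗ[k] A ⊗[k] H) (s : H →ₗ[k] H) (f : M' →ₗ[k] M) (t : M' ⊗[k] H) :
    twist φ s (f.rTensor H t) = twist (φ ∘ₗ f) s t := by
  induction t with
  | zero => simp
  | add t t' h h' => simp only [map_add, h, h']
  | tmul m h => simp

theorem twist_mul_left (φ : M →ₗ[k] A ⊗[k] H) (s : H →ₗ[k] H) (b : A ⊗[k] H) (t : M ⊗[k] H) :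
    twist (LinearMap.mulLeft k b ∘ₗ φ) s t = b * twist φ s t := by
  induction t with
  | zero => simp
  | add t t' h h' => simp only [map_add, h, h', mul_add]
  | tmul m h => simp [mul_assoc]

/-- `∑ φ(m₍₀₎) (1 ⊗ s(m₍₁₎) s'(m₍₂₎)) = φ(m)` if `s'` is a right convolution inverse of `s`. -/
theorem twist_twist (δ : RightComodule k H M) (φ : M →ₗ[k] A ⊗[k] H) (s s' : H →ₗ[k] H)
    (hs : ∀ h, LinearMap.mul' k H (TensorProduct.map s s' (Coalgebra.comul (R := k) h)) =
      algebraMap k H (Coalgebra.counit h)) (m : M) :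
    twist (twist φ s ∘ₗ δ.coact) s' (δ.coact m) = φ m := by
  have h1 : ∀ t : M ⊗[k] H, twist (twist φ s ∘ₗ δ.coact) s' t =
      twist φ LinearMap.id ((LinearMap.mul' k H ∘ₗ TensorProduct.map s s').lTensor M
        (TensorProduct.assoc k M H H (δ.coact.rTensor H t))) := by
    intro t
    induction t with
    | zero => simp
    | add t t' h h' => simp only [map_add, h, h']
    | tmul m h =>
      rw [LinearMap.rTensor_tmul, twist_tmul, LinearMap.comp_apply]
      induction δ.coact m with
      | zero => simp
      | add t t' h h' => simp only [map_add, h, h', TensorProduct.add_tmul, add_mul]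
      | tmul m' h' => simp [mul_assoc]
  have h2 : ∀ t : M ⊗[k] H, twist φ LinearMap.id
      ((LinearMap.mul' k H ∘ₗ TensorProduct.map s s').lTensor M
        ((Coalgebra.comul (R := k) (A := H)).lTensor M t)) =
      φ (slice M Coalgebra.counit t) := by
    intro t
    induction t with
    | zero => simp
    | add t t' h h' => simp only [map_add, h, h']
    | tmul m h =>
      rw [LinearMap.lTensor_tmul, LinearMap.lTensor_tmul, twist_tmul, LinearMap.comp_apply, hs,
        LinearMap.id_apply, slice_tmul, map_smul, Algebra.algebraMap_eq_smul_one,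
        TensorProduct.tmul_smul, ← Algebra.TensorProduct.one_def, mul_smul_comm, mul_one]
  rw [h1, δ.coassoc, h2, δ.slice_counit]

theorem twist_antipode_twist_id (δ : RightComodule k H M) (φ : M →ₗ[k] A ⊗[k] H) (m : M) :
    twist (twist φ (HopfAlgebra.antipode k) ∘ₗ δ.coact) LinearMap.id (δ.coact m) = φ m :=
  twist_twist δ φ _ _ (fun h => HopfAlgebra.mul_antipode_rTensor_comul_apply (R := k) h) m

theorem twist_id_twist_antipode (δ : RightComodule k H M) (φ : M →ₗ[k] A ⊗[k] H) (m : M) :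
    twist (twist φ LinearMap.id ∘ₗ δ.coact) (HopfAlgebra.antipode k) (δ.coact m) = φ m :=
  twist_twist δ φ _ _ (fun h => HopfAlgebra.mul_antipode_lTensor_comul_apply (R := k) h) m

end Twist

section Extension

variable {k : Type*} {H : Type*} [Field k] [Ring H] [HopfAlgebra k H]
  {A : Type*} [Ring A] [Algebra k A] (ρ : RightComoduleAlgebra k H A)
  {P : Type*} [AddCommGroup P] [Module k P] [Module Aᵐᵒᵖ P] [IsScalarTower k Aᵐᵒᵖ P]

/-- The map `A ⊗ H → A ⊗ H`, `a ⊗ h ↦ ρ(a) (1 ⊗ S(h))`. It is left linear from the action of `A`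
on the first factor to the action through `ρ`, and right linear the other way around. -/
noncomputable def untwist : A ⊗[k] H →ₗ[k] A ⊗[k] H := twist ρ.coact (HopfAlgebra.antipode k)

theorem untwist_coact (a : A) : untwist ρ (ρ.coact a) = a ⊗ₜ 1 := by
  have h1 := twist_id_twist_antipode ρ.toRightComodule ((TensorProduct.mk k A H).flip 1) a
  have h2 : twist ((TensorProduct.mk k A H).flip 1) LinearMap.id = LinearMap.id := by
    ext a h
    simp
  rwa [h2, LinearMap.id_comp] at h1

theorem untwist_mul_left (a : A) (t : A ⊗[k] H) :
    untwist ρ (a ⊗ₜ 1 * t) = ρ.coact a * untwist ρ t := by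
  induction t with
  | zero => simp
  | add t t' h h' => simp only [map_add, h, h', mul_add]
  | tmul b h => simp [untwist, ρ.coact_mul, mul_assoc]

theorem twist_antipode_tensorRightAction (φ : P →ₗ[k] A ⊗[k] H)
    (hφ : ∀ (p : P) (a : A), φ (MulOpposite.op a • p) = φ p * ρ.coact a) (t : P ⊗[k] H) (a : A) :
    twist φ (HopfAlgebra.antipode k) (tensorRightAction k H A P t (ρ.coact a)) =
      twist φ (HopfAlgebra.antipode k) t * (a ⊗ₜ 1) := by
  have h1 : ∀ (p : P) (h : H) (b : A ⊗[k] H),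
      twist φ (HopfAlgebra.antipode k) (tensorRightAction k H A P (p ⊗ₜ h) b) =
        φ p * untwist ρ b * (1 ⊗ₜ HopfAlgebra.antipode k h) := by
    intro p h b
    induction b with
    | zero => simp
    | add t t' h h' => simp only [map_add, h, h', mul_add, add_mul]
    | tmul a g => simp [untwist, hφ, HopfAlgebra.antipode_mul_antidistrib, mul_assoc]
  induction t with
  | zero => simp
  | add t t' h h' => simp only [map_add, LinearMap.add_apply, h, h', add_mul]
  | tmul p h => rw [h1, untwist_coact, twist_tmul]; simp [mul_assoc]

theorem untwist_mul_coact (t : A ⊗[k] H) (a : A) :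
    untwist ρ (t * ρ.coact a) = untwist ρ t * (a ⊗ₜ 1) := by
  have h1 : ∀ t b : A ⊗[k] H, tensorRightAction k H A A t b = t * b := by
    intro t b
    induction t with
    | zero => simp
    | add t t' h h' => simp only [map_add, LinearMap.add_apply, h, h', add_mul]
    | tmul p h =>
      induction b with
      | zero => simp
      | add t t' h h' => simp only [map_add, h, h', mul_add]
      | tmul a g => simp
  rw [← h1]
  exact twist_antipode_tensorRightAction ρ ρ.coact (fun b a => ρ.coact_mul b a) t a

theorem twist_id_tensorRightAction (ψ : P →ₗ[k] A ⊗[k] H)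
    (hψ : ∀ (p : P) (a : A), ψ (MulOpposite.op a • p) = ψ p * (a ⊗ₜ 1)) (t : P ⊗[k] H)
    (b : A ⊗[k] H) :
    twist ψ LinearMap.id (tensorRightAction k H A P t b) = twist ψ LinearMap.id t * b := by
  induction t with
  | zero => simp
  | add t t' h h' => simp only [map_add, LinearMap.add_apply, h, h', add_mul]
  | tmul p h =>
    induction b with
    | zero => simp
    | add t t' h h' => simp only [map_add, h, h', mul_add]
    | tmul a g => simp [hψ, mul_assoc]

theorem slice_mul_tmul_one (ξ : H →ₗ[k] k) (t : A ⊗[k] H) (a : A) :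
    slice A ξ (t * a ⊗ₜ 1) = slice A ξ t * a := by
  induction t with
  | zero => simp
  | add t t' h h' => simp only [map_add, h, h', add_mul]
  | tmul b h => simp

theorem lTensor_mul_tmul_one (s : H →ₗ[k] H) (t : A ⊗[k] H) (a : A) :
    s.lTensor A (t * a ⊗ₜ 1) = s.lTensor A t * a ⊗ₜ 1 := by
  induction t with
  | zero => simp
  | add t t' h h' => simp only [map_add, h, h', add_mul]
  | tmul b h => simp

/-- A slice of a homomorphism `P → A ⊗ H`, where `A` acts on the first factor of `A ⊗ H`. -/
noncomputable def sliceHom (ψ : P →ₗ[k] A ⊗[k] H)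
    (hψ : ∀ (p : P) (a : A), ψ (MulOpposite.op a • p) = ψ p * (a ⊗ₜ 1)) (ξ : H →ₗ[k] k) :
    P →ₗ[Aᵐᵒᵖ] A where
  toFun p := slice A ξ (ψ p)
  map_add' p p' := by rw [map_add, map_add]
  map_smul' a p := by
    obtain ⟨a, rfl⟩ := MulOpposite.op_surjective a
    rw [hψ, slice_mul_tmul_one]
    rfl

variable {ρ}

/-- The homomorphism `P → A ⊗ H`, `p ↦ ∑ ρ(f(p₍₀₎)) (1 ⊗ S(p₍₁₎))`, which is the coaction on
`f ∈ Hom_A(P, A)`. -/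
noncomputable def RightHopfModule.coactHom (σ : RightHopfModule ρ P) (f : P →ₗ[Aᵐᵒᵖ] A) :
    P →ₗ[k] A ⊗[k] H :=
  twist (ρ.coact ∘ₗ f.restrictScalars k) (HopfAlgebra.antipode k) ∘ₗ σ.coact

theorem RightHopfModule.coactHom_smul (σ : RightHopfModule ρ P) (f : P →ₗ[Aᵐᵒᵖ] A) (p : P)
    (a : A) : σ.coactHom f (MulOpposite.op a • p) = σ.coactHom f p * (a ⊗ₜ 1) := by
  rw [coactHom, LinearMap.comp_apply, σ.coact_smul]
  refine twist_antipode_tensorRightAction ρ _ (fun p a => ?_) _ a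
  simp [ρ.coact_mul]

theorem RightHopfModule.twist_coactHom (σ : RightHopfModule ρ P) (f : P →ₗ[Aᵐᵒᵖ] A) (p : P) :
    twist (σ.coactHom f) LinearMap.id (σ.coact p) = ρ.coact (f p) :=
  twist_antipode_twist_id σ.toRightComodule (ρ.coact ∘ₗ f.restrictScalars k) p

/-- The left ideal of all `a` such that `n ↦ ρ(a) (f(n) ⊗ 1)` extends to a homomorphism
`P → A ⊗ H` with respect to the action of `A` on the first factor. -/
def twistedExtensionIdeal (ρ : RightComoduleAlgebra k H A) (N : Submodule Aᵐᵒᵖ P)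
    (f : N →ₗ[Aᵐᵒᵖ] A) : Submodule A A where
  carrier := {a | ∃ Θ : P →ₗ[k] A ⊗[k] H,
    (∀ (p : P) (b : A), Θ (MulOpposite.op b • p) = Θ p * (b ⊗ₜ 1)) ∧
      ∀ n : N, Θ n = ρ.coact a * (f n ⊗ₜ 1)}
  add_mem' := by
    rintro a b ⟨Θ, h, h'⟩ ⟨Θ₂, h₂, h₂'⟩
    exact ⟨Θ + Θ₂, fun p b => by simp only [LinearMap.add_apply, h, h₂, add_mul],
      fun n => by simp only [LinearMap.add_apply, h', h₂', map_add, add_mul]⟩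
  zero_mem' := ⟨0, by simp, by simp⟩
  smul_mem' := by
    rintro c a ⟨Θ, h, h'⟩
    exact ⟨LinearMap.mulLeft k (ρ.coact c) ∘ₗ Θ, fun p b => by simp [h, mul_assoc],
      fun n => by simp [h', mul_assoc, ρ.coact_mul]⟩

theorem isSubcomodule_twistedExtensionIdeal {P : Type*} [AddCommGroup P] [Module k P]
    [Module Aᵐᵒᵖ P] (N : Submodule Aᵐᵒᵖ P) (f : N →ₗ[Aᵐᵒᵖ] A) :
    ρ.toRightComodule.IsSubcomodule ((twistedExtensionIdeal ρ N f).restrictScalars k) := by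
  rw [RightComodule.isSubcomodule_iff]
  rintro a ⟨Θ, h, h'⟩ ξ
  refine ⟨(coregular ξ).lTensor A ∘ₗ Θ, fun p b => ?_, fun n => ?_⟩
  · rw [LinearMap.comp_apply, h, lTensor_mul_tmul_one, LinearMap.comp_apply]
  · rw [LinearMap.comp_apply, h', lTensor_mul_tmul_one, ρ.coact_slice]

/-- Let `N ⊆ P` be Hopf modules, `N` finitely generated. If each homomorphism `N → A` extends to
`P` up to left factors from an essential left ideal, then it extends to `P`. Indeed, the cokernel
`E` of `Hom_A(P, A) → Hom_A(N, A)` is a left Hopf module, and for the class `v` of `f` the kernel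
of `a ↦ ρ(a)(v ⊗ 1) ∈ E ⊗ H` is a stable left ideal of `A`. It contains the `a` with
`a v₍₀₎ ⊗ v₍₁₎ = 0`, since `ρ(a)(v ⊗ 1) = ρ(a v₍₀₎)(1 ⊗ S(v₍₁₎))`. Hence it is not zero and so
contains `1`. -/
theorem RightHopfModule.IsHopfSub.exists_extension (hsimple : ρ.IsSimpleLeftHopf)
    {σ : RightHopfModule ρ P} {N : Submodule Aᵐᵒᵖ P} (hN : σ.IsHopfSub N) (hfg : N.FG)
    (hess : ∀ h : N →ₗ[Aᵐᵒᵖ] A, IsEssentialSubmodule (extensionIdeal N h))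
    (f : N →ₗ[Aᵐᵒᵖ] A) : ∃ g : P →ₗ[Aᵐᵒᵖ] A, ∀ n : N, g n = f n := by
  obtain ⟨hnt, hsimple⟩ := hsimple
  obtain ⟨τ, hτ⟩ := hN.exists_hopfModule
  let b := Module.Basis.ofVectorSpace k H
  let F := fun i => sliceHom (τ.coactHom f) (τ.coactHom_smul f) (b.coord i)
  have hF : ∀ i n, F i n = slice A (b.coord i) (τ.coactHom f n) := fun _ _ => rfl
  obtain ⟨s, hs⟩ : ∃ s : Finset _, ∀ i ∉ s, F i = 0 := by
    classical
    have : Module.Finite Aᵐᵒᵖ N := Module.Finite.of_fg hfg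
    obtain ⟨S, hS⟩ := Module.Finite.fg_top (R := Aᵐᵒᵖ) (M := N)
    choose s hs using fun n => (exists_sum_slice b (τ.coactHom f n)).1
    refine ⟨S.biUnion s, fun i hi => ?_⟩
    refine LinearMap.ext_on hS fun n hn => hs n i fun hin => hi ?_
    exact Finset.mem_biUnion.2 ⟨n, hn, hin⟩
  have hcoact : ∀ n, τ.coactHom f n = ∑ i ∈ s, F i n ⊗ₜ b i := fun n =>
    (exists_sum_slice b (τ.coactHom f n)).2 s fun i hi => by rw [← hF, hs i hi, LinearMap.zero_apply]
  obtain ⟨a, ha, ha0⟩ : ∃ a ∈ ⨅ i : s, extensionIdeal N (F i), a ≠ 0 := by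
    refine Submodule.exists_mem_ne_zero_of_ne_bot fun h => ?_
    have h1 : (⊤ : Submodule A A) = ⊥ :=
      IsEssentialSubmodule.iInf (fun i : s => hess (F i)) ⊤ (by rw [h]; exact disjoint_bot_right)
    exact bot_ne_top h1.symm
  rw [Submodule.mem_iInf] at ha
  choose g hg using ha
  -- an extension of `(a ⊗ 1) • coactHom f`
  let Ψ : P →ₗ[k] A ⊗[k] H :=
    ∑ i : s, (TensorProduct.mk k A H).flip (b i) ∘ₗ (g i).restrictScalars k
  have hΨ : ∀ p, Ψ p = ∑ i : s, g i p ⊗ₜ b i := fun p => by simp [Ψ]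
  have hΨs : ∀ (p : P) (c : A), Ψ (MulOpposite.op c • p) = Ψ p * (c ⊗ₜ 1) := fun p c => by
    simp [hΨ, Finset.sum_mul]
  have hΨN : Ψ ∘ₗ N.subtype.restrictScalars k =
      LinearMap.mulLeft k (a ⊗ₜ 1) ∘ₗ τ.coactHom f := by
    ext n
    rw [LinearMap.comp_apply, LinearMap.comp_apply, hcoact, LinearMap.mulLeft_apply,
      Finset.mul_sum, ← Finset.sum_coe_sort s]
    refine (hΨ n).trans (Finset.sum_congr rfl fun i _ => ?_)
    rw [hg, Algebra.TensorProduct.tmul_mul_tmul, one_mul]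
  have hmem : a ∈ twistedExtensionIdeal ρ N f := by
    refine ⟨untwist ρ ∘ₗ twist Ψ LinearMap.id ∘ₗ σ.coact, fun p c => ?_, fun n => ?_⟩
    · simp only [LinearMap.comp_apply]
      rw [σ.coact_smul, twist_id_tensorRightAction Ψ hΨs, untwist_mul_coact]
    · simp only [LinearMap.comp_apply]
      rw [show (n : P) = N.subtype n from rfl, ← hτ, twist_rTensor, hΨN, twist_mul_left,
        τ.twist_coactHom, untwist_mul_left, untwist_coact]
  have htop : twistedExtensionIdeal ρ N f = ⊤ := by
    refine (hsimple _ (isSubcomodule_twistedExtensionIdeal N f)).resolve_left fun h => ha0 ?_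
    rwa [h, Submodule.mem_bot] at hmem
  obtain ⟨Θ, hΘ, hΘN⟩ : (1 : A) ∈ twistedExtensionIdeal ρ N f := htop ▸ Submodule.mem_top
  refine ⟨sliceHom Θ hΘ Coalgebra.counit, fun n => ?_⟩
  change slice A Coalgebra.counit (Θ n) = f n
  rw [hΘN, ρ.coact_one, one_mul, slice_tmul, Bialgebra.counit_one, one_smul]

end Extension

/-! ### The trace ideal -/

section Trace

variable {k : Type*} {H : Type*} [Field k] [Ring H] [HopfAlgebra k H]
  {A : Type*} [Ring A] [Algebra k A] {ρ : RightComoduleAlgebra k H A}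
  {Y : Type*} [AddCommGroup Y] [Module k Y] [Module Aᵐᵒᵖ Y] [IsScalarTower k Aᵐᵒᵖ Y]

/-- The trace ideal `∑ f(Y)`, over all homomorphisms `f : Y → A`. -/
def traceIdeal (A : Type*) [Ring A] (Y : Type*) [AddCommGroup Y] [Module Aᵐᵒᵖ Y] :
    Submodule A A :=
  Submodule.span A {a | ∃ (f : Y →ₗ[Aᵐᵒᵖ] A) (y : Y), f y = a}

theorem slice_mul_one_tmul (ξ : H →ₗ[k] k) (t : A ⊗[k] H) (g : H) :
    slice A ξ (t * 1 ⊗ₜ g) = slice A (ξ ∘ₗ LinearMap.mulRight k g) t := by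
  induction t with
  | zero => simp
  | add t t' h h' => simp only [map_add, h, h', add_mul]
  | tmul b h => simp

theorem slice_tmul_mul (ξ : H →ₗ[k] k) (a : A) (g : H) (t : A ⊗[k] H) :
    slice A ξ (a ⊗ₜ g * t) = a * slice A (ξ ∘ₗ LinearMap.mulLeft k g) t := by
  induction t with
  | zero => simp
  | add t t' h h' => simp only [map_add, h, h', mul_add]
  | tmul b h => simp

theorem RightHopfModule.isSubcomodule_traceIdeal (σ : RightHopfModule ρ Y) :
    ρ.toRightComodule.IsSubcomodule ((traceIdeal A Y).restrictScalars k) := by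
  rw [RightComodule.isSubcomodule_iff]
  intro a ha
  rw [Submodule.restrictScalars_mem] at ha
  induction ha using Submodule.span_induction with
  | zero => simp
  | add a a' _ _ h h' => exact fun ξ => by simpa using add_mem (h ξ) (h' ξ)
  | smul c a _ h =>
    intro ξ
    rw [smul_eq_mul, ρ.coact_mul]
    induction ρ.coact c with
    | zero => simp
    | add t t' h h' => rw [add_mul, map_add]; exact add_mem h h'
    | tmul b g =>
      rw [slice_tmul_mul]
      exact Submodule.smul_mem (traceIdeal A Y) b (h _)
  | mem a ha =>
    obtain ⟨f, y, rfl⟩ := ha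
    intro ξ
    rw [← σ.twist_coactHom]
    induction σ.coact y with
    | zero => simp
    | add t t' h h' => rw [map_add, map_add]; exact add_mem h h'
    | tmul y g =>
      rw [twist_tmul, slice_mul_one_tmul]
      exact Submodule.subset_span ⟨sliceHom (σ.coactHom f) (σ.coactHom_smul f) _, y, rfl⟩

/-- A nonzero projective Hopf module `Y` is a generator, and so `Y = Y J` fails for each proper
ideal `J`; here `J` is the kernel of a homomorphism of rings. -/
theorem RightHopfModule.exists_not_mem_closure_smul (hsimple : ρ.IsSimpleLeftHopf)
    (σ : RightHopfModule ρ Y) [Nontrivial Y] [Module.Projective Aᵐᵒᵖ Y] {R : Type*} [Ring R]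
    [Nontrivial R] (q : A →+* R) :
    ∃ y : Y, y ∉ AddSubgroup.closure {z : Y | ∃ (a : A) (y : Y), q a = 0 ∧ MulOpposite.op a • y = z} := by
  by_contra! hall
  have hq : ∀ (f : Y →ₗ[Aᵐᵒᵖ] A) (y : Y), q (f y) = 0 := by
    intro f y
    induction hall y using AddSubgroup.closure_induction with
    | zero => simp
    | add y y' _ _ h h' => rw [map_add, map_add, h, h', add_zero]
    | neg y _ h => rw [map_neg, map_neg, h, neg_zero]
    | mem z hz =>
      obtain ⟨a, y, ha, rfl⟩ := hz
      rw [map_smul, op_smul_eq_mul, map_mul, ha, mul_zero]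
  have h1 : ∀ a ∈ traceIdeal A Y, q a = 0 := by
    intro a ha
    induction ha using Submodule.span_induction with
    | zero => simp
    | add a b _ _ h h' => rw [map_add, h, h', add_zero]
    | smul c a _ h => rw [smul_eq_mul, map_mul, h, mul_zero]
    | mem a ha =>
      obtain ⟨f, y, rfl⟩ := ha
      exact hq f y
  rcases hsimple.2 _ σ.isSubcomodule_traceIdeal with h | h
  · obtain ⟨s, hs⟩ := Module.projective_def.1 ‹Module.Projective Aᵐᵒᵖ Y›
    obtain ⟨y, hy⟩ := exists_ne (0 : Y)
    refine hy ?_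
    have h2 : s y = 0 := by
      ext z
      have h3 : (MulOpposite.unop (s y z)) ∈ traceIdeal A Y :=
        Submodule.subset_span ⟨((MulOpposite.opLinearEquiv Aᵐᵒᵖ (M := A)).symm.toLinearMap).comp
          ((Finsupp.lapply z).comp s), y, rfl⟩
      rw [h, Submodule.mem_bot] at h3
      simpa using h3
    rw [← hs y, h2, map_zero]
  · have := h1 1 (h ▸ Submodule.mem_top)
    rw [map_one] at this
    exact one_ne_zero this

end Trace

/-! ### Free covers of Hopf modules -/

section Cover

variable {k : Type*} {H : Type*} [Field k] [Ring H] [HopfAlgebra k H]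
  {A : Type*} [Ring A] [Algebra k A] {C : Type*} [AddCommGroup C] [Module k C]

/-- The map `(A ⊗ L) ⊗ (C ⊗ L) → (A ⊗ C) ⊗ L`, `(a ⊗ x) ⊗ (c ⊗ y) ↦ (a ⊗ c) ⊗ y x`. -/
noncomputable def tensorCoact (A C : Type*) [AddCommGroup A] [Module k A] [AddCommGroup C]
    [Module k C] (L : Type*) [Ring L] [Algebra k L] :
    (A ⊗[k] L) ⊗[k] (C ⊗[k] L) →ₗ[k] (A ⊗[k] C) ⊗[k] L :=
  (LinearMap.mul' k L ∘ₗ (TensorProduct.comm k L L).toLinearMap).lTensor (A ⊗[k] C) ∘ₗ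
    (TensorProduct.tensorTensorTensorComm k A L C L).toLinearMap

@[simp] theorem tensorCoact_tmul {L : Type*} [Ring L] [Algebra k L] (a : A) (c : C) (x y : L) :
    tensorCoact A C L ((a ⊗ₜ[k] x) ⊗ₜ (c ⊗ₜ y)) = (a ⊗ₜ c) ⊗ₜ (y * x) := by
  simp [tensorCoact]

theorem lTensor_comul_tensorCoact (t : A ⊗[k] H) (t' : C ⊗[k] H) :
    (Coalgebra.comul (R := k) (A := H)).lTensor (A ⊗[k] C) (tensorCoact A C H (t ⊗ₜ t')) =
      tensorCoact A C (H ⊗[k] H) (((Coalgebra.comul (R := k) (A := H)).lTensor A t) ⊗ₜ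
        ((Coalgebra.comul (R := k) (A := H)).lTensor C t')) := by
  induction t with
  | zero => simp
  | add t s h h' => simp only [map_add, TensorProduct.add_tmul, h, h']
  | tmul a x =>
    induction t' with
    | zero => simp
    | add t s h h' => simp only [map_add, TensorProduct.tmul_add, h, h']
    | tmul c y => simp [Bialgebra.comul_mul]

theorem slice_counit_tensorCoact (t : A ⊗[k] H) (t' : C ⊗[k] H) :
    slice (A ⊗[k] C) Coalgebra.counit (tensorCoact A C H (t ⊗ₜ t')) =
      slice A Coalgebra.counit t ⊗ₜ slice C Coalgebra.counit t' := by
  induction t with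
  | zero => simp
  | add t s h h' => simp only [map_add, TensorProduct.add_tmul, h, h']
  | tmul a x =>
    induction t' with
    | zero => simp
    | add t s h h' => simp only [map_add, TensorProduct.tmul_add, h, h']
    | tmul c y => simp [Bialgebra.counit_mul, TensorProduct.smul_tmul', TensorProduct.tmul_smul, smul_smul]

theorem assoc_tensorCoact (α : A →ₗ[k] A ⊗[k] H) (γ : C →ₗ[k] C ⊗[k] H) (t : A ⊗[k] H)
    (t' : C ⊗[k] H) :
    TensorProduct.assoc k (A ⊗[k] C) H H ((tensorCoact A C H ∘ₗ TensorProduct.map α γ).rTensor H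
        (tensorCoact A C H (t ⊗ₜ t'))) =
      tensorCoact A C (H ⊗[k] H) (TensorProduct.assoc k A H H (α.rTensor H t) ⊗ₜ
        TensorProduct.assoc k C H H (γ.rTensor H t')) := by
  induction t with
  | zero => simp
  | add t s h h' => simp only [map_add, TensorProduct.add_tmul, h, h']
  | tmul a x =>
    induction t' with
    | zero => simp
    | add t s h h' => simp only [map_add, TensorProduct.tmul_add, h, h']
    | tmul c y =>
      rw [tensorCoact_tmul, LinearMap.rTensor_tmul, LinearMap.rTensor_tmul, LinearMap.rTensor_tmul,
        LinearMap.comp_apply, TensorProduct.map_tmul]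
      induction α a with
      | zero => simp
      | add t s h h' => simp only [map_add, TensorProduct.add_tmul, h, h']
      | tmul a' x' =>
        induction γ c with
        | zero => simp
        | add t s h h' => simp only [map_add, TensorProduct.tmul_add, TensorProduct.add_tmul, h, h']
        | tmul c' y' => simp

variable (ρ : RightComoduleAlgebra k H A)

theorem tensorCoact_smul (t b : A ⊗[k] H) (t' : C ⊗[k] H) :
    tensorCoact A C H ((t * b) ⊗ₜ t') =
      tensorRightAction k H A (A ⊗[k] C) (tensorCoact A C H (t ⊗ₜ t')) b := by
  induction t with
  | zero => simp
  | add t s h h' => simp only [map_add, TensorProduct.add_tmul, LinearMap.add_apply, add_mul, h, h']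
  | tmul a x =>
    induction t' with
    | zero => simp
    | add t s h h' => simp only [map_add, TensorProduct.tmul_add, LinearMap.add_apply, h, h']
    | tmul c y =>
      induction b with
      | zero => simp
      | add t s h h' => simp only [map_add, mul_add, TensorProduct.add_tmul, h, h']
      | tmul b z => simp [TensorProduct.smul_tmul', mul_assoc]

/-- The free Hopf module `A ⊗ C` on a comodule `C`, with coaction
`a ⊗ c ↦ ∑ a₍₀₎ ⊗ c₍₀₎ ⊗ c₍₁₎ a₍₁₎`. -/
noncomputable def freeHopfModule (δ : RightComodule k H C) : RightHopfModule ρ (A ⊗[k] C) where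
  coact := tensorCoact A C H ∘ₗ TensorProduct.map ρ.coact δ.coact
  coassoc t := by
    induction t with
    | zero => simp
    | add t s h h' => simp only [map_add, h, h']
    | tmul a c =>
      rw [LinearMap.comp_apply, TensorProduct.map_tmul, assoc_tensorCoact,
        lTensor_comul_tensorCoact, ρ.coassoc, δ.coassoc]
  counit t := by
    change slice (A ⊗[k] C) Coalgebra.counit _ = t
    induction t with
    | zero => simp
    | add t s h h' => simp only [map_add, h, h']
    | tmul a c =>
      rw [LinearMap.comp_apply, TensorProduct.map_tmul, slice_counit_tensorCoact,
        ρ.slice_counit, δ.slice_counit]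
  coact_smul t b := by
    induction t with
    | zero => simp
    | add t s h h' => simp only [smul_add, map_add, LinearMap.add_apply, h, h']
    | tmul a c =>
      rw [TensorProduct.smul_tmul', op_smul_eq_mul, LinearMap.comp_apply, LinearMap.comp_apply,
        TensorProduct.map_tmul, TensorProduct.map_tmul, ρ.coact_mul, tensorCoact_smul]

variable {ρ} {P : Type*} [AddCommGroup P] [Module k P] [Module Aᵐᵒᵖ P] [IsScalarTower k Aᵐᵒᵖ P]

/-- The homomorphism `A ⊗ C → P`, `a ⊗ c ↦ c a`, for a subspace `C` of `P`. -/
noncomputable def actionHom (C : Submodule k P) : A ⊗[k] C →ₗ[Aᵐᵒᵖ] P where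
  toFun := TensorProduct.lift ((rightAction k A P).flip.compl₂ C.subtype)
  map_add' := map_add _
  map_smul' b t := by
    obtain ⟨b, rfl⟩ := MulOpposite.op_surjective b
    induction t with
    | zero => simp
    | add t s h h' => simp only [smul_add, map_add, h, h']
    | tmul a c =>
      rw [TensorProduct.smul_tmul', op_smul_eq_mul]
      change MulOpposite.op (a * b) • (c : P) = MulOpposite.op b • MulOpposite.op a • (c : P)
      rw [MulOpposite.op_mul, mul_smul]

theorem actionHom_tmul (C : Submodule k P) (a : A) (c : C) :
    actionHom C (a ⊗ₜ[k] c) = MulOpposite.op a • (c : P) := rfl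

theorem isHopfMap_actionHom (σ : RightHopfModule ρ P) (C : Submodule k P)
    (δ : RightComodule k H C) (hδ : ∀ c, C.subtype.rTensor H (δ.coact c) = σ.coact c) :
    IsHopfMap (freeHopfModule ρ δ) σ (actionHom C) := by
  intro t
  induction t with
  | zero => simp
  | add t s h h' => simp only [map_add, h, h']
  | tmul a c =>
    rw [actionHom_tmul, σ.coact_smul, ← hδ]
    change ((actionHom C).restrictScalars k).rTensor H
      (tensorCoact A C H (ρ.coact a ⊗ₜ δ.coact c)) = _
    induction ρ.coact a with
    | zero => simp
    | add t s h h' => simp only [map_add, TensorProduct.add_tmul, h, h']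
    | tmul a' x =>
      induction δ.coact c with
      | zero => simp
      | add t s h h' => simp only [map_add, TensorProduct.tmul_add, LinearMap.add_apply, h, h']
      | tmul c' y =>
        rw [tensorCoact_tmul, LinearMap.rTensor_tmul, LinearMap.rTensor_tmul,
          tensorRightAction_tmul]
        rfl

/-- Each finitely generated Hopf module is a quotient of a Hopf module which is free of finite rank
over `A`. -/
theorem RightHopfModule.exists_free_cover (σ : RightHopfModule ρ P) [Module.Finite Aᵐᵒᵖ P] :
    ∃ (n : ℕ) (τ : RightHopfModule ρ (Fin n → A)) (p : (Fin n → A) →ₗ[Aᵐᵒᵖ] P),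
      Function.Surjective p ∧ IsHopfMap τ σ p := by
  obtain ⟨C, hfin, hC, hspan⟩ := σ.exists_finite_generating
  obtain ⟨δ, hδ⟩ := σ.toRightComodule.exists_of_injective C.subtype C.subtype_injective
    fun m ξ => ⟨⟨_, (RightComodule.isSubcomodule_iff _ _).1 hC m m.2 ξ⟩, rfl⟩
  have hmap := isHopfMap_actionHom σ C δ hδ
  let n := Module.finrank k C
  let e₀ : A ⊗[k] C ≃ₗ[k] (Fin n → A) :=
    (TensorProduct.congr (LinearEquiv.refl k A) (Module.finBasis k C).equivFun).trans
      (TensorProduct.piScalarRight k k A (Fin n))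
  have he₀ : ∀ (b : Aᵐᵒᵖ) (t : A ⊗[k] C), e₀ (b • t) = b • e₀ t := by
    intro b t
    induction t with
    | zero => simp
    | add t s h h' => simp only [smul_add, map_add, h, h']
    | tmul a c =>
      ext i
      simp [e₀, TensorProduct.smul_tmul']
  let e : A ⊗[k] C ≃ₗ[Aᵐᵒᵖ] (Fin n → A) := { e₀ with map_smul' := he₀ }
  obtain ⟨τ, hτ⟩ := (freeHopfModule ρ δ).exists_of_surjective e.toLinearMap e.surjective (by
    rw [LinearEquiv.ker]
    exact RightHopfModule.isHopfSub_bot _)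
  refine ⟨n, τ, (actionHom C).comp e.symm.toLinearMap, ?_, fun v => ?_⟩
  · rw [← LinearMap.range_eq_top, eq_top_iff, ← hspan, Submodule.span_le]
    intro c hc
    refine ⟨e (1 ⊗ₜ ⟨c, hc⟩), ?_⟩
    rw [LinearMap.comp_apply, LinearEquiv.coe_coe, LinearEquiv.symm_apply_apply, actionHom_tmul,
      MulOpposite.op_one, one_smul]
  · obtain ⟨t, rfl⟩ := e.surjective v
    have h1 := hτ t
    simp only [LinearEquiv.coe_coe] at h1
    rw [← h1, ← LinearMap.comp_apply, ← LinearMap.rTensor_comp]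
    simp only [LinearMap.comp_apply, LinearEquiv.coe_coe, LinearEquiv.symm_apply_apply]
    rw [← hmap t]
    congr 2
    ext t
    simp

end Cover

/-! ### Finitely generated Hopf modules -/

section Free

variable {A : Type w} [Ring A]

instance projective_fin_pi (n : ℕ) : Module.Projective Aᵐᵒᵖ (Fin n → A) :=
  Module.Projective.of_equiv
    (LinearEquiv.piCongrRight fun _ : Fin n => (MulOpposite.opLinearEquiv Aᵐᵒᵖ (M := A)).symm)

instance finite_fin_pi (n : ℕ) : Module.Finite Aᵐᵒᵖ (Fin n → A) :=
  Module.Finite.equiv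
    (LinearEquiv.piCongrRight fun _ : Fin n => (MulOpposite.opLinearEquiv Aᵐᵒᵖ (M := A)).symm)

theorem eq_sum_op_smul_single {n : ℕ} (v : Fin n → A) :
    v = ∑ i, MulOpposite.op (v i) • (Pi.single i 1 : Fin n → A) := by
  ext i
  simp [Finset.sum_apply, Pi.single_apply]

theorem exists_retraction_of_extension {P : Type*} [AddCommGroup P] [Module Aᵐᵒᵖ P]
    {N : Submodule Aᵐᵒᵖ P} (hfg : N.FG) [Module.Projective Aᵐᵒᵖ N]
    (h : ∀ f : N →ₗ[Aᵐᵒᵖ] A, ∃ g : P →ₗ[Aᵐᵒᵖ] A, ∀ n : N, g n = f n) :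
    ∃ r : P →ₗ[Aᵐᵒᵖ] N, ∀ n : N, r n = n := by
  have : Module.Finite Aᵐᵒᵖ N := Module.Finite.of_fg hfg
  obtain ⟨m, q, hq⟩ := Module.Finite.exists_fin' Aᵐᵒᵖ N
  obtain ⟨s, hs⟩ := Module.projective_lifting_property q LinearMap.id hq
  choose g hg using fun i : Fin m => h
    ((MulOpposite.opLinearEquiv Aᵐᵒᵖ (M := A)).symm.toLinearMap ∘ₗ LinearMap.proj i ∘ₗ s)
  refine ⟨q ∘ₗ LinearMap.pi fun i =>
    (MulOpposite.opLinearEquiv Aᵐᵒᵖ (M := A)).toLinearMap ∘ₗ g i, fun n => ?_⟩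
  refine Eq.trans ?_ (LinearMap.congr_fun hs n)
  rw [LinearMap.comp_apply, LinearMap.comp_apply]
  congr 1
  ext i
  simp [hg]

theorem projective_of_retraction {P : Type*} [AddCommGroup P] [Module Aᵐᵒᵖ P]
    [Module.Projective Aᵐᵒᵖ P] {N : Submodule Aᵐᵒᵖ P} (r : P →ₗ[Aᵐᵒᵖ] N)
    (hr : ∀ n : N, r n = n) : Module.Projective Aᵐᵒᵖ N :=
  Module.Projective.of_split N.subtype r (LinearMap.ext hr)

theorem projective_quotient_of_retraction {P : Type*} [AddCommGroup P] [Module Aᵐᵒᵖ P]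
    [Module.Projective Aᵐᵒᵖ P] {N : Submodule Aᵐᵒᵖ P} (r : P →ₗ[Aᵐᵒᵖ] N)
    (hr : ∀ n : N, r n = n) : Module.Projective Aᵐᵒᵖ (P ⧸ N) := by
  refine projective_of_retraction_ker N.mkQ N.mkQ_surjective
    ((Submodule.inclusion (Submodule.ker_mkQ N).ge).comp r) fun y hy => ?_
  rw [Submodule.ker_mkQ] at hy
  exact congrArg Subtype.val (hr ⟨y, hy⟩)

end Free

section FiniteHopf

variable {k : Type*} {H : Type*} [Field k] [Ring H] [HopfAlgebra k H]
  {A : Type w} [Ring A] [Algebra k A] {ρ : RightComoduleAlgebra k H A}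

/-- A Hopf submodule which is not finitely generated contains a strictly increasing sequence of
finitely generated Hopf submodules. -/
theorem RightHopfModule.IsHopfSub.exists_strictMono {P : Type*} [AddCommGroup P] [Module k P]
    [Module Aᵐᵒᵖ P] [IsScalarTower k Aᵐᵒᵖ P] {σ : RightHopfModule ρ P} {K : Submodule Aᵐᵒᵖ P}
    (hK : σ.IsHopfSub K) (hfg : ¬ K.FG) :
    ∃ N : ℕ → Submodule Aᵐᵒᵖ P, (∀ i, (N i).FG ∧ σ.IsHopfSub (N i)) ∧ ∀ i, N i < N (i + 1) := by
  have step : ∀ s : {N : Submodule Aᵐᵒᵖ P // N.FG ∧ σ.IsHopfSub N ∧ N ≤ K},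
      ∃ s' : {N : Submodule Aᵐᵒᵖ P // N.FG ∧ σ.IsHopfSub N ∧ N ≤ K}, s.1 < s'.1 := by
    rintro ⟨N, hN, hN', hNK⟩
    obtain ⟨x, hxK, hxN⟩ := SetLike.exists_of_lt (lt_of_le_of_ne hNK fun h => hfg (h ▸ hN))
    obtain ⟨L, hxL, hL, hL', hmin⟩ := σ.exists_fg_hopfSub x
    refine ⟨⟨N ⊔ L, hN.sup hL, hN'.sup hL', sup_le hNK (hmin K hK hxK)⟩, ?_⟩
    exact SetLike.lt_iff_le_and_exists.2 ⟨le_sup_left, x, Submodule.mem_sup_right hxL, hxN⟩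
  choose f hf using step
  let N : ℕ → {N : Submodule Aᵐᵒᵖ P // N.FG ∧ σ.IsHopfSub N ∧ N ≤ K} :=
    fun n => f^[n] ⟨⊥, Submodule.fg_bot, σ.isHopfSub_bot, bot_le⟩
  refine ⟨fun n => (N n).1, fun i => ⟨(N i).2.1, (N i).2.2.1⟩, fun i => ?_⟩
  have hN : N (i + 1) = f (N i) := Function.iterate_succ_apply' _ _ _
  beta_reduce
  rw [hN]
  exact hf _

/-- Let finitely generated Hopf submodules of free modules of finite rank be direct summands, and
let them satisfy the ascending chain condition. Then finitely generated Hopf modules are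
projective. -/
theorem RightHopfModule.projective_of_finite
    (hsplit : ∀ (n : ℕ) (τ : RightHopfModule ρ (Fin n → A)) (N : Submodule Aᵐᵒᵖ (Fin n → A)),
      τ.IsHopfSub N → N.FG → ∃ r : (Fin n → A) →ₗ[Aᵐᵒᵖ] N, ∀ m : N, r m = m)
    (hchain : ∀ (n : ℕ) (τ : RightHopfModule ρ (Fin n → A))
      (N : ℕ → Submodule Aᵐᵒᵖ (Fin n → A)), (∀ i, (N i).FG ∧ τ.IsHopfSub (N i)) →
        ¬ ∀ i, N i < N (i + 1))
    {P : Type*} [AddCommGroup P] [Module k P] [Module Aᵐᵒᵖ P] [IsScalarTower k Aᵐᵒᵖ P]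
    (σ : RightHopfModule ρ P) [Module.Finite Aᵐᵒᵖ P] : Module.Projective Aᵐᵒᵖ P := by
  obtain ⟨n, τ, p, hp, hτ⟩ := σ.exists_free_cover
  have hK := hτ.isHopfSub_ker
  have hfg : (LinearMap.ker p).FG := by
    by_contra h
    obtain ⟨N, hN, hlt⟩ := hK.exists_strictMono h
    exact hchain n τ N hN hlt
  obtain ⟨r, hr⟩ := hsplit n τ _ hK hfg
  exact projective_of_retraction_ker p hp r fun y hy => congrArg Subtype.val (hr ⟨y, hy⟩)

end FiniteHopf

/-! ### Semiprime Goldie rings -/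

section GoldieCase

variable {k : Type*} {H : Type*} [Field k] [Ring H] [HopfAlgebra k H]
  {A : Type w} [Ring A] [Algebra k A] {ρ : RightComoduleAlgebra k H A}

theorem RightHopfModule.IsHopfSub.exists_retraction_of_projective (hsimple : ρ.IsSimpleLeftHopf)
    (hs : IsSemiprimeRing A) (hG : IsRightGoldie A) (hl : HasFiniteUniformDim A A) {n : ℕ}
    {τ : RightHopfModule ρ (Fin n → A)} {N : Submodule Aᵐᵒᵖ (Fin n → A)} (hN : τ.IsHopfSub N)
    (hfg : N.FG) [Module.Projective Aᵐᵒᵖ N] :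
    ∃ r : (Fin n → A) →ₗ[Aᵐᵒᵖ] N, ∀ m : N, r m = m :=
  exists_retraction_of_extension hfg
    (hN.exists_extension hsimple hfg (isEssentialSubmodule_extensionIdeal hs hG hl N))

/-- Induction on the flat dimension of `N`: the syzygy `K` in a cover `Aᵐ → N` is projective by
induction, and being a Hopf submodule of `Aᵐ` it is then a direct summand. -/
theorem RightHopfModule.IsHopfSub.projective_of_charDimLE (hsimple : ρ.IsSimpleLeftHopf)
    (hs : IsSemiprimeRing A) (hG : IsRightGoldie A) (hl : HasFiniteUniformDim A A)
    (hcoh : IsRightCoherent A) (d : ℕ) : ∀ {n : ℕ} {τ : RightHopfModule ρ (Fin n → A)}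
    {N : Submodule Aᵐᵒᵖ (Fin n → A)}, τ.IsHopfSub N → N.FG → CharDimLE A d N →
    Module.Projective Aᵐᵒᵖ N := by
  induction d with
  | zero =>
    intro n τ N _ hfg hd
    have := hcoh.finitePresentation_of_fg N hfg
    exact projective_of_finitePresentation_of_injective (charDimLE_zero_iff.1 hd)
  | succ d ih =>
    intro n τ N hN hfg hd
    have := hcoh.finitePresentation_of_fg N hfg
    obtain ⟨τN, -⟩ := hN.exists_hopfModule
    obtain ⟨m, τ', p, hp, hτ'⟩ := τN.exists_free_cover
    have hK := hτ'.isHopfSub_ker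
    have hKfg : (LinearMap.ker p).FG := Module.FinitePresentation.fg_ker p hp
    have := ih hK hKfg (CharDimLE.ker_of_succ p hp injective_rightChar_of_projective hd)
    obtain ⟨r, hr⟩ := hK.exists_retraction_of_projective hsimple hs hG hl hKfg
    exact projective_of_retraction_ker p hp r fun y hy => congrArg Subtype.val (hr ⟨y, hy⟩)

theorem HasFiniteUniformDim.not_strictMono_of_retraction {R M : Type*} [Ring R] [AddCommGroup M]
    [Module R M] (h : HasFiniteUniformDim R M) (N : ℕ → Submodule R M)
    (hr : ∀ i, ∃ r : M →ₗ[R] N i, ∀ m : N i, r m = m) : ¬ ∀ i, N i < N (i + 1) := by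
  intro hlt
  choose r hr using hr
  refine h ⟨fun i => N (i + 1) ⊓ LinearMap.ker (r i), fun i hi => ?_,
    iSupIndep_of_monotone (K := N) (fun i => inf_le_left) (fun i => (hlt i).le) fun i => ?_⟩
  · obtain ⟨x, hx, hx'⟩ := Set.exists_of_ssubset (hlt i)
    have h1 : x - r i x ∈ N (i + 1) ⊓ LinearMap.ker (r i) :=
      ⟨sub_mem hx ((hlt i).le (r i x).2), by
        rw [SetLike.mem_coe, LinearMap.mem_ker, map_sub, hr, sub_self]⟩
    have h2 := hi.le h1
    rw [Submodule.mem_bot, sub_eq_zero] at h2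
    exact hx' (h2 ▸ (r i x).2)
  · rw [Submodule.disjoint_def]
    rintro x ⟨-, hx⟩ hx'
    have h1 : r i x = ⟨x, hx'⟩ := hr i ⟨x, hx'⟩
    rw [SetLike.mem_coe, LinearMap.mem_ker, h1] at hx
    exact congrArg Subtype.val hx

theorem RightHopfModule.projective_of_finite_of_isGoldie (hsimple : ρ.IsSimpleLeftHopf)
    (hs : IsSemiprimeRing A) (hG : IsRightGoldie A) (hl : HasFiniteUniformDim A A)
    (hcoh : IsRightCoherent A) {d : ℕ}
    (hd : ∀ (V : Type w) [AddCommGroup V] [Module Aᵐᵒᵖ V], CharDimLE A d V)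
    {P : Type*} [AddCommGroup P] [Module k P] [Module Aᵐᵒᵖ P] [IsScalarTower k Aᵐᵒᵖ P]
    (σ : RightHopfModule ρ P) [Module.Finite Aᵐᵒᵖ P] : Module.Projective Aᵐᵒᵖ P := by
  have hsplit : ∀ (n : ℕ) (τ : RightHopfModule ρ (Fin n → A)) (N : Submodule Aᵐᵒᵖ (Fin n → A)),
      τ.IsHopfSub N → N.FG → ∃ r : (Fin n → A) →ₗ[Aᵐᵒᵖ] N, ∀ m : N, r m = m := by
    intro n τ N hN hfg
    have := hN.projective_of_charDimLE hsimple hs hG hl hcoh d hfg (hd N)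
    exact hN.exists_retraction_of_projective hsimple hs hG hl hfg
  exact RightHopfModule.projective_of_finite hsplit (fun n τ N hN =>
    (hG.1.pi_fin n).not_strictMono_of_retraction N
      fun i => hsplit n τ _ (hN i).2 (hN i).1) σ

end GoldieCase

section Noetherian

variable {A : Type w} [Ring A]

theorem IsTwoSidedNoetherian.isRightGoldie (h : IsTwoSidedNoetherian A) : IsRightGoldie A := by
  have := h.2
  exact ⟨hasFiniteUniformDim_of_isNoetherian,
    fun I _ => monotone_stabilizes_iff_noetherian.2 inferInstance I⟩

theorem IsTwoSidedNoetherian.isRightCoherent (h : IsTwoSidedNoetherian A) :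
    IsRightCoherent A := by
  have := h.2
  have : IsNoetherianRing Aᵐᵒᵖ :=
    isNoetherian_of_linearEquiv (MulOpposite.opLinearEquiv Aᵐᵒᵖ (M := A))
  intro I hI
  have : Module.Finite Aᵐᵒᵖ I := Module.Finite.of_fg hI
  exact Module.finitePresentation_of_finite Aᵐᵒᵖ I

end Noetherian

/-! ### Von Neumann regular rings -/

section Regular

variable {A : Type w} [Ring A]

/-- Finitely generated right ideals of a von Neumann regular ring have left identity elements. -/
theorem IsVonNeumannRegular.exists_left_identity (h : IsVonNeumannRegular A)
    (I : Submodule Aᵐᵒᵖ A) (hI : I.FG) : ∃ e ∈ I, ∀ x ∈ I, e * x = x := by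
  induction I, hI using Submodule.fg_induction with
  | singleton x =>
    obtain ⟨b, hb⟩ := h x
    refine ⟨x * b, Submodule.mem_span_singleton.2 ⟨MulOpposite.op b, rfl⟩, fun y hy => ?_⟩
    obtain ⟨r, rfl⟩ := Submodule.mem_span_singleton.1 hy
    rw [mul_smul_comm, hb]
  | sup I₁ I₂ _ _ h₁ h₂ =>
    obtain ⟨e₁, he₁, h₁⟩ := h₁
    obtain ⟨e₂, he₂, h₂⟩ := h₂
    obtain ⟨b, hb⟩ := h (e₂ - e₁ * e₂)
    -- with `y = (1 - e₁) e₂` and `y b y = y`, take `e₁ + y b (1 - e₁)`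
    have hmul : ∀ {I : Submodule Aᵐᵒᵖ A} {x : A}, x ∈ I → ∀ c : A, x * c ∈ I :=
      fun hx c => Submodule.smul_mem _ (MulOpposite.op c) hx
    have hy : e₂ - e₁ * e₂ ∈ I₁ ⊔ I₂ :=
      sub_mem (Submodule.mem_sup_right he₂) (Submodule.mem_sup_left (hmul he₁ _))
    refine ⟨e₁ + (e₂ - e₁ * e₂) * (b * (1 - e₁)), add_mem (Submodule.mem_sup_left he₁)
      (hmul hy _), fun x hx => ?_⟩
    obtain ⟨x₁, hx₁, x₂, hx₂, rfl⟩ := Submodule.mem_sup.1 hx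
    have k₁ : (e₁ + (e₂ - e₁ * e₂) * (b * (1 - e₁))) * x₁ = x₁ := by
      have : (1 - e₁) * x₁ = 0 := by rw [sub_mul, one_mul, h₁ x₁ hx₁, sub_self]
      rw [add_mul, mul_assoc, mul_assoc, this, mul_zero, mul_zero, add_zero, h₁ x₁ hx₁]
    have k₂ : (e₁ + (e₂ - e₁ * e₂) * (b * (1 - e₁))) * x₂ = x₂ := by
      have k₃ : (1 - e₁) * x₂ = (e₂ - e₁ * e₂) * x₂ := by
        rw [sub_mul, sub_mul, one_mul, mul_assoc, h₂ x₂ hx₂]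
      rw [add_mul, mul_assoc, mul_assoc, k₃, ← mul_assoc, ← mul_assoc, hb, ← k₃, sub_mul, one_mul,
        add_sub_cancel]
    rw [mul_add, k₁, k₂]

/-- Finitely generated submodules of `Aⁿ` are direct summands if `A` is von Neumann regular. -/
theorem IsVonNeumannRegular.exists_retraction (h : IsVonNeumannRegular A) {n : ℕ}
    (N : Submodule Aᵐᵒᵖ (Fin n → A)) (hN : N.FG) :
    ∃ r : (Fin n → A) →ₗ[Aᵐᵒᵖ] N, ∀ m : N, r m = m := by
  induction n with
  | zero => exact ⟨0, fun m => Subsingleton.elim _ _⟩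
  | succ n ih =>
    have hfin : Module.Finite Aᵐᵒᵖ N := Module.Finite.of_fg hN
    let π : (Fin (n + 1) → A) →ₗ[Aᵐᵒᵖ] A := LinearMap.proj 0
    obtain ⟨e, he, hid⟩ := h.exists_left_identity (N.map π) (hN.map π)
    obtain ⟨u, hu, hue⟩ := he
    let tail : (Fin (n + 1) → A) →ₗ[Aᵐᵒᵖ] (Fin n → A) := LinearMap.funLeft Aᵐᵒᵖ A Fin.succ
    -- `v ↦ v - u v₀` is a projection of `N` onto the kernel `N₀` of `π` on `N`
    let t : (Fin (n + 1) → A) →ₗ[Aᵐᵒᵖ] (Fin (n + 1) → A) :=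
      LinearMap.id - (LinearMap.pi fun i => leftMul (u i)) ∘ₗ π
    have ht : ∀ v, t v = v - MulOpposite.op (v 0) • u := fun v => rfl
    have htN : ∀ v ∈ N, t v ∈ N ∧ t v 0 = 0 := by
      intro v hv
      refine ⟨ht v ▸ sub_mem hv (N.smul_mem _ hu), ?_⟩
      have h1 : u 0 = e := hue
      rw [ht, Pi.sub_apply, Pi.smul_apply, op_smul_eq_mul, h1,
        hid (v 0) ⟨v, hv, rfl⟩, sub_self]
    obtain ⟨r, hr⟩ := ih (N.map (tail ∘ₗ t)) (hN.map _)
    -- the inverse of `tail` on `N₀`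
    let z : (Fin n → A) →ₗ[Aᵐᵒᵖ] (Fin (n + 1) → A) :=
      LinearMap.pi (Fin.cases 0 fun i => LinearMap.proj i)
    have hz : ∀ v : Fin (n + 1) → A, v 0 = 0 → z (tail v) = v := by
      intro v hv
      ext i
      refine Fin.cases ?_ (fun i => ?_) i
      · exact hv.symm
      · rfl
    have hzN : ∀ y ∈ N.map (tail ∘ₗ t), z y ∈ N := by
      rintro _ ⟨v, hv, rfl⟩
      rw [LinearMap.comp_apply, hz _ (htN v hv).2]
      exact (htN v hv).1
    refine ⟨LinearMap.codRestrict N ((LinearMap.pi fun i => leftMul (u i)) ∘ₗ π +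
      z ∘ₗ (Submodule.subtype _) ∘ₗ r ∘ₗ tail ∘ₗ t) fun v => ?_, fun m => Subtype.ext ?_⟩
    · exact add_mem (N.smul_mem (MulOpposite.op (v 0)) hu) (hzN _ (r _).2)
    · have h1 := hr ⟨tail (t m), ⟨m, m.2, rfl⟩⟩
      change MulOpposite.op ((m : Fin (n + 1) → A) 0) • u + z (r (tail (t m))) = m
      rw [h1]
      change MulOpposite.op ((m : Fin (n + 1) → A) 0) • u + z (tail (t m)) = m
      rw [hz _ (htN m m.2).2, ht, add_sub_cancel]

variable {k : Type*} {H : Type*} [Field k] [Ring H] [HopfAlgebra k H]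
  [Algebra k A] {ρ : RightComoduleAlgebra k H A}

/-- For finitely generated Hopf submodules `N < N'` of `Aⁿ`, the quotient `N' / N` is a nonzero
projective Hopf module, whence `N' ⊈ N + N' J` for the kernel `J` of `A → R`. As `N'` is a direct
summand of `Aⁿ`, the images of `N` and `N'` in `Rⁿ` are different. -/
theorem IsVonNeumannRegular.not_strictMono (h : IsVonNeumannRegular A)
    (hsimple : ρ.IsSimpleLeftHopf) {R : Type*} [Ring R] [IsSimpleRing R] [IsArtinianRing R]
    (q : A →+* R) (hq : Function.Surjective q) {n : ℕ} (τ : RightHopfModule ρ (Fin n → A))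
    (N : ℕ → Submodule Aᵐᵒᵖ (Fin n → A)) (hN : ∀ i, (N i).FG ∧ τ.IsHopfSub (N i)) :
    ¬ ∀ i, N i < N (i + 1) := by
  intro hlt
  have hsurj : RingHomSurjective q.op := ⟨fun r => by
    obtain ⟨a, ha⟩ := hq r.unop
    exact ⟨MulOpposite.op a, congrArg MulOpposite.op ha⟩⟩
  have hnoeth : IsNoetherian Rᵐᵒᵖ (Fin n → R) := by
    have : IsNoetherianRing Rᵐᵒᵖ := inferInstance
    exact isNoetherian_of_linearEquiv
      (LinearEquiv.piCongrRight fun _ : Fin n => (MulOpposite.opLinearEquiv Rᵐᵒᵖ (M := R)).symm)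
  let Q : (Fin n → A) →ₛₗ[q.op] (Fin n → R) :=
    { toFun := fun v i => q (v i)
      map_add' := fun v v' => by ext i; simp
      map_smul' := fun a v => by ext i; simp }
  obtain ⟨i, hi⟩ := monotone_stabilizes_iff_noetherian.2 hnoeth
    ⟨fun i => (N i).map Q, monotone_nat_of_le_succ fun i => Submodule.map_mono (hlt i).le⟩
  have hi' : (N i).map Q = (N (i + 1)).map Q := hi (i + 1) i.le_succ
  obtain ⟨r, hr⟩ := h.exists_retraction _ (hN i).1
  obtain ⟨r', hr'⟩ := h.exists_retraction _ (hN (i + 1)).1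
  have hproj := projective_of_retraction r' hr'
  obtain ⟨τ₁, hτ₁⟩ := (hN (i + 1)).2.exists_hopfModule
  let L : Submodule Aᵐᵒᵖ (N (i + 1)) := (N i).comap (N (i + 1)).subtype
  obtain ⟨τ₂, -⟩ := (hτ₁.isHopfSub_comap (hN i).2).exists_quotient
  have hY : Module.Projective Aᵐᵒᵖ (N (i + 1) ⧸ L) := by
    refine projective_quotient_of_retraction (LinearMap.codRestrict L
      ((Submodule.inclusion (hlt i).le) ∘ₗ r ∘ₗ (N (i + 1)).subtype) fun m => (r _).2)
      fun m => Subtype.ext (Subtype.ext ?_)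
    exact congrArg (Subtype.val : N i → Fin n → A) (hr (⟨((m : N (i + 1)) : Fin n → A), m.2⟩ : N i))
  have hnt : Nontrivial (N (i + 1) ⧸ L) := by
    rw [Submodule.Quotient.nontrivial_iff]
    intro htop
    refine (hlt i).not_ge fun x hx => ?_
    have : (⟨x, hx⟩ : N (i + 1)) ∈ L := htop ▸ Submodule.mem_top
    exact this
  obtain ⟨y, hy⟩ := τ₂.exists_not_mem_closure_smul hsimple q
  refine hy ?_
  obtain ⟨z, rfl⟩ := L.mkQ_surjective y
  obtain ⟨z', hz', hzz'⟩ : Q z ∈ (N i).map Q := hi' ▸ ⟨z, z.2, rfl⟩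
  let v : N (i + 1) := z - ⟨z', (hlt i).le hz'⟩
  have hv : ∀ j, q ((v : Fin n → A) j) = 0 := by
    intro j
    have := congrFun hzz' j
    change q (z' j) = q ((z : Fin n → A) j) at this
    change q ((z : Fin n → A) j - z' j) = 0
    rw [map_sub, this, sub_self]
  have hzv : L.mkQ z = L.mkQ v := by
    rw [← sub_eq_zero, ← map_sub, ← LinearMap.mem_ker, Submodule.ker_mkQ]
    change ((z - v : N (i + 1)) : Fin n → A) ∈ N i
    simpa [v] using hz'
  have hsum : L.mkQ v = ∑ j, MulOpposite.op ((v : Fin n → A) j) • L.mkQ (r' (Pi.single j 1)) := by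
    conv_lhs => rw [← hr' v, eq_sum_op_smul_single (v : Fin n → A), map_sum, map_sum]
    simp only [map_smul]
  rw [hzv, hsum]
  exact sum_mem fun j _ => AddSubgroup.subset_closure ⟨_, _, hv j, rfl⟩

theorem RightHopfModule.projective_of_finite_of_isVonNeumannRegular (hsimple : ρ.IsSimpleLeftHopf)
    (h : IsVonNeumannRegular A) (hR : HasSimpleArtinianFactor A)
    {P : Type*} [AddCommGroup P] [Module k P] [Module Aᵐᵒᵖ P] [IsScalarTower k Aᵐᵒᵖ P]
    (σ : RightHopfModule ρ P) [Module.Finite Aᵐᵒᵖ P] : Module.Projective Aᵐᵒᵖ P := by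
  obtain ⟨R, _, q, hq, _, _⟩ := hR
  exact RightHopfModule.projective_of_finite (fun n τ N _ hfg => h.exists_retraction N hfg)
    (fun n τ N hN => h.not_strictMono hsimple q hq τ N hN) σ

end Regular

/-! ### Hopf modules of arbitrary size -/

section Infinite

variable {k : Type*} {H : Type*} [Field k] [Ring H] [HopfAlgebra k H]
  {A : Type*} [Ring A] [Algebra k A] {ρ : RightComoduleAlgebra k H A}
  {P : Type x} [AddCommGroup P] [Module k P] [Module Aᵐᵒᵖ P] [IsScalarTower k Aᵐᵒᵖ P]

/-- If finitely generated Hopf modules are projective, so are all. A section of a surjection onto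
`P`, defined on a Hopf submodule `D`, extends to `D + N` for a finitely generated Hopf submodule
`N`, since `N / (N ∩ D)` is projective; so a maximal such section is defined everywhere. -/
theorem RightHopfModule.projective_of_forall_finite (σ : RightHopfModule ρ P)
    (hfin : ∀ (Y : Type x) [AddCommGroup Y] [Module k Y] [Module Aᵐᵒᵖ Y] [IsScalarTower k Aᵐᵒᵖ Y]
      (_ : RightHopfModule ρ Y) [Module.Finite Aᵐᵒᵖ Y], Module.Projective Aᵐᵒᵖ Y) :
    Module.Projective Aᵐᵒᵖ P := by
  refine Module.Projective.of_lifting_property'' fun f hf => ?_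
  let S : Set (P →ₗ.[Aᵐᵒᵖ] (P →₀ Aᵐᵒᵖ)) := {s | σ.IsHopfSub s.domain ∧ ∀ x : s.domain, f (s x) = x}
  obtain ⟨s, -, hs⟩ := zorn_le_nonempty₀ S (by
    intro c hc hchain s₀ hs₀
    have hdir := hchain.directedOn
    refine ⟨LinearPMap.sSup c hdir, ⟨fun x hx ξ => ?_, fun x => ?_⟩,
      fun s hs => LinearPMap.le_sSup hdir hs⟩
    · obtain ⟨s, hs, hxs⟩ := (LinearPMap.mem_domain_sSup_iff ⟨s₀, hs₀⟩ hdir).1 hx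
      exact (LinearPMap.mem_domain_sSup_iff ⟨s₀, hs₀⟩ hdir).2 ⟨s, hs, (hc hs).1 x hxs ξ⟩
    · obtain ⟨s, hs, hxs⟩ := (LinearPMap.mem_domain_sSup_iff ⟨s₀, hs₀⟩ hdir).1 x.2
      exact (congrArg f (LinearPMap.sSup_apply hdir hs ⟨x, hxs⟩)).trans ((hc hs).2 ⟨x, hxs⟩))
    ⊥ ⟨σ.isHopfSub_bot, fun x => by
      have hx : (x : P) = 0 := (Submodule.mem_bot Aᵐᵒᵖ).1 x.2
      have : x = 0 := Subtype.ext hx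
      rw [this]
      simp⟩
  have htop : s.domain = ⊤ := by
    by_contra hne
    obtain ⟨x, -, hx⟩ := SetLike.exists_of_lt (lt_top_iff_ne_top.2 hne)
    obtain ⟨N, hxN, hNfg, hN, -⟩ := σ.exists_fg_hopfSub x
    have hNfin : Module.Finite Aᵐᵒᵖ N := Module.Finite.of_fg hNfg
    obtain ⟨τ, hτ⟩ := hN.exists_hopfModule
    let D : Submodule Aᵐᵒᵖ N := s.domain.comap N.subtype
    obtain ⟨τ', -⟩ := (hτ.isHopfSub_comap hs.prop.1).exists_quotient
    have hproj : Module.Projective Aᵐᵒᵖ (N ⧸ D) := hfin (N ⧸ D) τ'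
    obtain ⟨t, ht⟩ := Module.projective_lifting_property D.mkQ LinearMap.id D.mkQ_surjective
    obtain ⟨u, hu⟩ := Module.projective_lifting_property f (N.subtype ∘ₗ t) hf
    have ht' : ∀ y, D.mkQ (t y) = y := LinearMap.congr_fun ht
    have hu' : ∀ y, f (u y) = t y := LinearMap.congr_fun hu
    have hinj : Function.Injective (N.subtype ∘ₗ t) :=
      N.subtype_injective.comp (Function.LeftInverse.injective ht')
    let e := LinearEquiv.ofInjective (N.subtype ∘ₗ t) hinj
    let s' : P →ₗ.[Aᵐᵒᵖ] (P →₀ Aᵐᵒᵖ) := ⟨LinearMap.range (N.subtype ∘ₗ t), u ∘ₗ e.symm.toLinearMap⟩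
    have hs' : ∀ y : s'.domain, f (s' y) = y := by
      intro y
      obtain ⟨y, rfl⟩ := e.surjective y
      change f (u (e.symm (e y))) = _
      rw [LinearEquiv.symm_apply_apply, hu']
      rfl
    have hdisj : Disjoint s.domain s'.domain := by
      rw [Submodule.disjoint_def]
      rintro _ hy ⟨y, rfl⟩
      have h1 : D.mkQ (t y) = 0 := by
        rw [← LinearMap.mem_ker, Submodule.ker_mkQ]
        exact hy
      rw [ht'] at h1
      rw [h1, map_zero]
    have hsup : s.domain ⊔ s'.domain = s.domain ⊔ N := by
      refine le_antisymm (sup_le_sup_left ?_ _) (sup_le le_sup_left fun z hz => ?_)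
      · rintro _ ⟨y, rfl⟩
        exact (t y).2
      · have h1 : (⟨z, hz⟩ - t (D.mkQ ⟨z, hz⟩) : N) ∈ D := by
          refine (Submodule.Quotient.mk_eq_zero D).1 ?_
          change D.mkQ (_ - _) = 0
          rw [map_sub, ht', sub_self]
        have h2 : z - t (D.mkQ ⟨z, hz⟩) ∈ s.domain := h1
        rw [← sub_add_cancel z (t (D.mkQ ⟨z, hz⟩) : P)]
        exact Submodule.add_mem_sup h2 ⟨_, rfl⟩
    have hmem : s.sup s' (LinearPMap.sup_h_of_disjoint s s' hdisj) ∈ S := by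
      refine ⟨?_, fun z => ?_⟩
      · rw [LinearPMap.domain_sup, hsup]
        exact hs.prop.1.sup hN
      · obtain ⟨a, ha, b, hb, hab⟩ := Submodule.mem_sup.1 z.2
        rw [LinearPMap.sup_apply _ ⟨a, ha⟩ ⟨b, hb⟩ z hab, map_add, hs.prop.2, hs']
        exact hab
    have hle := (hs.le_of_ge hmem (LinearPMap.left_le_sup _ _ _)).1
    rw [LinearPMap.domain_sup, hsup] at hle
    exact hx (hle (Submodule.mem_sup_right hxN))
  refine ⟨s.toFun ∘ₗ (LinearEquiv.ofTop _ htop).symm.toLinearMap, ?_⟩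
  ext x
  exact hs.prop.2 ⟨x, htop ▸ Submodule.mem_top⟩

end Infinite

end HopfMod

theorem corollary4p5 {k : Type*} {H : Type*} {A : Type*} [Field k] [Ring H] [HopfAlgebra k H]
    [Ring A] [Algebra k A] (ρ : HopfMod.RightComoduleAlgebra k H A)
    (hsimple : ρ.IsSimpleLeftHopf)
    (hA :
      (HopfMod.IsSemiprimeRing A ∧ HopfMod.IsTwoSidedNoetherian A ∧ HopfMod.HasFiniteGlobalDim A) ∨
      (HopfMod.IsSemiprimeRing A ∧ HopfMod.IsLeftGoldie A ∧ HopfMod.IsRightGoldie A ∧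
        HopfMod.IsRightCoherent A ∧ HopfMod.HasFiniteWeakDim A) ∨
      (HopfMod.IsVonNeumannRegular A ∧ HopfMod.HasSimpleArtinianFactor A))
    (M : Type*) [AddCommGroup M] [Module k M] [Module Aᵐᵒᵖ M] [IsScalarTower k Aᵐᵒᵖ M]
    (_σ : HopfMod.RightHopfModule ρ M) :
    Module.Projective Aᵐᵒᵖ M := by
  refine _σ.projective_of_forall_finite fun Y _ _ _ _ τ _ => ?_
  rcases hA with ⟨hs, hN, n, hn⟩ | ⟨hs, hl, hr, hcoh, n, hn⟩ | ⟨hreg, hR⟩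
  · have := hN.1
    exact τ.projective_of_finite_of_isGoldie hsimple hs hN.isRightGoldie
      HopfMod.hasFiniteUniformDim_of_isNoetherian hN.isRightCoherent
      fun V _ _ => HopfMod.charDimLE_of_hasProjectiveDimensionLE n V (hn (ModuleCat.of _ V))
  · exact τ.projective_of_finite_of_isGoldie hsimple hs hr hl.1 hcoh
      fun V _ _ => HopfMod.charDimLE_of_flatDimLE n V (hn V)
  · exact τ.projective_of_finite_of_isVonNeumannRegular hsimple hreg hR
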